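/- Let $1 \le r \le d$ and $m \ge 0$ be integers, and let $\delta > 0$, $C_0 > 13$, $\beta \ge 0$, $\nu = 2\beta/\delta$. Let $G \subset \mathbb{C}^d$ be a finite set of unit vectors which, with a sampling distribution $\mu$ carried by $G$ (for instance the uniform one), forms a spherical 2-design: the average of $(ww^\dagger)\otimes(ww^\dagger)$ over $w \sim \mu$ equals its average over a uniformly random unit vector of $\mathbb{C}^d$. Put $A = \{[(d+1)d]^{1/4} w : w \in G\}$, draw $w_1,\dots,w_m$ independently from $\mu$, let $a_i = [(d+1)d]^{1/4} w_i$, and set $\mathcal{A}(Z) = (a_i^\dagger Z a_i)_{i=1}^m \in \mathbb{R}^m$ for Hermitian $Z \in \mathbb{C}^{d\times d}$. Call $Z$ non-spiky if $|a^\dagger Z a| \le \beta\sqrt{1+1/d}$ for all $a \in A$. Let $\|\cdot\|_*$ denote the nuclear norm and $\|\cdot\|_F$ the Frobenius norm. Suppose that $$ m \ge \Bigl(8 C_0 \nu^2 \bigl(1+\tfrac1d\bigr)\Bigr)^2\, r d \log(2d). $$ Then with probability at least $$ 1 - \exp\Bigl(-\tfrac{1}{128}\, m\, \bigl(\nu^2(1+\tfrac1d)\bigr)^{-2}\Bigr)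 $$ over the choice of the $a_i$ (with probability $1$ if $\beta = 0$), the following holds simultaneously for all $\eta \ge 0$, all non-spiky Hermitian $X_{\mathrm{true}} \in \mathbb{C}^{d\times d}$ of rank at most $r$ with $\|X_{\mathrm{true}}\|_* \le 1$, and all $\varepsilon \in \mathbb{R}^m$ with $\|\varepsilon\|_2 \le \eta$. With $y = \mathcal{A}(X_{\mathrm{true}}) + \varepsilon$, every minimizer $X_{\mathrm{opt}}$ of $\|Z\|_*$ over the non-spiky Hermitian matrices $Z \in \mathbb{C}^{d\times d}$ with $\|\mathcal{A}(Z) - y\|_2 \le \eta$ satisfies $$ \|X_{\mathrm{opt}} - X_{\mathrm{true}}\|_F \le \max\Bigl\{\delta,\ \tfrac{16\,\eta\,\nu^2}{\sqrt m}\bigl(1+\tfrac1d\bigr)\bigl(1+\tfrac{13}{C_0-13}\bigr)\Bigr\}. $$ (If $m = 0$, which is possible only for $\beta = 0$, the second term is read as $0$.) -/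

import Mathlib

open MeasureTheory ProbabilityTheory

noncomputable section

namespace NonSpikyPhaseLift

/-- A finite set `G` of unit vectors of `ℂ^d`, together with a sampling distribution `μ` carried
by `G`, is a (complex) spherical `2`-design: the average of `(w w†) ⊗ (w w†)` over `w ∼ μ` is
its average over the uniformly distributed unit vector. The identity is written entry by entry.
The unweighted design `G` is the case in which `μ` is uniform on `G`. -/
structure IsSphericalTwoDesign {d : ℕ} (G : Set (EuclideanSpace ℂ (Fin d)))
    (μ : Measure (EuclideanSpace ℂ (Fin d))) : Prop where
  finite : G.Finite
  norm_eq_one : ∀ w ∈ G, ‖w‖ = 1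
  isProbabilityMeasure : IsProbabilityMeasure μ
  carried : μ Gᶜ = 0
  moment : ∀ i k j l : Fin d,
    ∫ w, (w i * star (w k)) * (w j * star (w l)) ∂μ =
      ⨍ u : Metric.sphere (0 : EuclideanSpace ℂ (Fin d)) 1,
        (u.1 i * star (u.1 k)) * (u.1 j * star (u.1 l))
          ∂((volume : Measure (EuclideanSpace ℂ (Fin d))).toSphere)

/-- The rescaled vector `[(d+1)d]^{1/4} w`. -/
def rescale {d : ℕ} (w : EuclideanSpace ℂ (Fin d)) : EuclideanSpace ℂ (Fin d) :=
  ((((d : ℝ) + 1) * d) ^ (1 / 4 : ℝ)) • w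

/-- The quadratic form `a† Z a`, which is real for Hermitian `Z`. -/
def quadForm {d : ℕ} (Z : Matrix (Fin d) (Fin d) ℂ) (a : EuclideanSpace ℂ (Fin d)) : ℝ :=
  (∑ i, ∑ j, star (a i) * Z i j * a j).re

/-- The sampling operator `𝒜(Z) = (a_i† Z a_i)_i`, with values in `ℝ^m` with the `ℓ₂` norm. -/
def sampling {d m : ℕ} (a : Fin m → EuclideanSpace ℂ (Fin d)) (Z : Matrix (Fin d) (Fin d) ℂ) :
    EuclideanSpace ℝ (Fin m) :=
  WithLp.toLp 2 fun i => quadForm Z (a i)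

/-- The nuclear norm: the sum of the singular values. -/
def nuclearNorm {d : ℕ} (Z : Matrix (Fin d) (Fin d) ℂ) : ℝ :=
  ∑ i : Fin d, (Matrix.toEuclideanLin Z).singularValues i

/-- The Frobenius norm. -/
def frobeniusNorm {d : ℕ} (Z : Matrix (Fin d) (Fin d) ℂ) : ℝ :=
  √(∑ i, ∑ j, ‖Z i j‖ ^ 2)

/-- Non-spikiness with respect to the set `A` of rescaled vectors, with parameter `β`. -/
def IsNonSpiky {d : ℕ} (A : Set (EuclideanSpace ℂ (Fin d))) (β : ℝ)
    (Z : Matrix (Fin d) (Fin d) ℂ) : Prop :=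
  ∀ a ∈ A, |quadForm Z a| ≤ β * √(1 + 1 / (d : ℝ))

/-- The feasible points of the convex program. -/
structure IsFeasible {d m : ℕ} (A : Set (EuclideanSpace ℂ (Fin d))) (β η : ℝ)
    (a : Fin m → EuclideanSpace ℂ (Fin d)) (y : EuclideanSpace ℝ (Fin m))
    (Z : Matrix (Fin d) (Fin d) ℂ) : Prop where
  isHermitian : Z.IsHermitian
  close : ‖sampling a Z - y‖ ≤ η
  isNonSpiky : IsNonSpiky A β Z

/-- `Z` is a solution of the convex program: it has least nuclear norm among the feasible
points. -/
def IsSolution {d m : ℕ} (A : Set (EuclideanSpace ℂ (Fin d))) (β η : ℝ)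
    (a : Fin m → EuclideanSpace ℂ (Fin d)) (y : EuclideanSpace ℝ (Fin m))
    (Z : Matrix (Fin d) (Fin d) ℂ) : Prop :=
  IsFeasible A β η a y Z ∧ ∀ Z', IsFeasible A β η a y Z' → nuclearNorm Z ≤ nuclearNorm Z'

/-- The uniform recovery guarantee for the measurement vectors `a`: for every noise level `η`,
every Hermitian `X` of rank at most `r` and nuclear norm at most `1` that is non-spiky, every
noise vector `ε` of norm at most `η`, and every solution `Z` of the convex program with data
`𝒜(X) + ε`, the Frobenius error is at most `max {δ, κ η}`. -/
def RecoversUniformly {d m : ℕ} (A : Set (EuclideanSpace ℂ (Fin d))) (r : ℕ) (β δ κ : ℝ)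
    (a : Fin m → EuclideanSpace ℂ (Fin d)) : Prop :=
  ∀ (η : ℝ) (X : Matrix (Fin d) (Fin d) ℂ), X.IsHermitian → X.rank ≤ r → nuclearNorm X ≤ 1 →
    IsNonSpiky A β X →
    ∀ ε : EuclideanSpace ℝ (Fin m), ‖ε‖ ≤ η →
    ∀ Z : Matrix (Fin d) (Fin d) ℂ, IsSolution A β η a (sampling a X + ε) Z →
      frobeniusNorm (Z - X) ≤ max δ (κ * η)

end NonSpikyPhaseLift

end

noncomputable section

namespace NonSpikyPhaseLift

/-! Deterministic part. The true matrix `X` is feasible, so a minimizer `Z` has nuclear norm at most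
that of `X`, and `H = Z - X` lies in the descent cone: the part of `H` off the range of `X` has
nuclear norm at most `√r ‖H‖_F`, whence `|tr (S H)| ≤ 3 √r ‖S‖ ‖H‖_F` for Hermitian `S`
(`abs_re_trace_mul_le_of_descent`). If `‖H‖_F > δ`, then `H / ‖H‖_F` is an `IsErrorDirection`: its
quadratic form is bounded on the rescaled design by `b = ν √(1 + 1/d)`. Both matrices fit the data
up to `η`, so `‖𝒜(H)‖₂ ≤ 2η`. A lower bound `m / (8b)` for the `ℓ₁` norm of the samples of every
error direction therefore gives `‖H‖_F ≤ 16 b η / √m`.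

Lower bound. For a 2-design the mean of `(a† H a)²` is `‖H‖_F² + (tr H)² ≥ 1`, and `|a† H a| ≤ b`
turns this into a mean of at least `1/b` for `|a† H a|`. The largest deficit of the sampled `ℓ₁`
norm below its mean, over all error directions, is controlled in two stages: its expectation by
symmetrization and contraction (`expect_iSup_centered_abs_le`), its fluctuation by McDiarmid's
inequality (`mcdiarmid`). After symmetrization, the descent cone bound leaves the expected operator
norm of `∑ ±a_i a_i†`.

Operator norm. The potential is `tr cosh (θ S)`. When `a a†` is added with a random sign, the
moments `a† (S + t a a†)^k a` obey a scalar recursion, because the perturbation has rank one.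
Chebyshev's sum inequality compares them with the commuting case, and integrating in `t` and summing
the series gives `rankOne_perturb_traceCosh`. Averaging over the design multiplies the potential by
at most `1 + (cosh (θR) - 1) / d` per sample, with `R = √(d(d+1))`. The choice of `θ` and Jensen's
inequality for `log` give `exists_expect_opNorm_signedSum_le`.

As the design is finite, expectations are finite sums; only `measureReal_setOf_le_expect` returns to
the probability space. -/

/-! ### Scalar moment recursions and Chebyshev's inequality -/

/-- Chebyshev's sum inequality with weights, for similarly ordered families. -/
lemma weighted_chebyshev {ι : Type*} [Fintype ι] (p f g : ι → ℝ) (hp : ∀ i, 0 ≤ p i)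
    (h : ∀ i j, 0 ≤ (f i - f j) * (g i - g j)) :
    (∑ i, p i * f i) * (∑ i, p i * g i) ≤ (∑ i, p i) * ∑ i, p i * (f i * g i) := by
  have h0 : 0 ≤ ∑ i, ∑ j, p i * p j * ((f i - f j) * (g i - g j)) :=
    Finset.sum_nonneg fun i _ => Finset.sum_nonneg fun j _ =>
      mul_nonneg (mul_nonneg (hp i) (hp j)) (h i j)
  have h1 : ∑ i, ∑ j, p i * p j * ((f i - f j) * (g i - g j)) =
      2 * ((∑ i, p i) * ∑ i, p i * (f i * g i)) -
        2 * ((∑ i, p i * f i) * (∑ i, p i * g i)) := by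
    have e1 : (∑ i, p i) * ∑ i, p i * (f i * g i) = ∑ i, ∑ j, p i * (p j * (f j * g j)) :=
      Finset.sum_mul_sum ..
    have e2 : (∑ i, p i) * ∑ i, p i * (f i * g i) = ∑ i, ∑ j, p i * (f i * g i) * p j := by
      rw [mul_comm]; exact Finset.sum_mul_sum ..
    have e3 : (∑ i, p i * f i) * (∑ i, p i * g i) = ∑ i, ∑ j, p i * f i * (p j * g j) :=
      Finset.sum_mul_sum ..
    have e4 : (∑ i, p i * f i) * (∑ i, p i * g i) = ∑ i, ∑ j, p i * g i * (p j * f j) := by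
      rw [mul_comm]; exact Finset.sum_mul_sum ..
    rw [two_mul, two_mul]
    nth_rewrite 1 [e1]
    rw [e2]
    nth_rewrite 1 [e3]
    rw [e4]
    simp only [← Finset.sum_add_distrib, ← Finset.sum_sub_distrib]
    refine Finset.sum_congr rfl fun i _ => Finset.sum_congr rfl fun j _ => by ring
  linarith

/-- The part of `(x + y) ^ k` which is even in `y`. -/
def evenPow (k : ℕ) (x y : ℝ) : ℝ := ((x + y) ^ k + (x - y) ^ k) / 2

/-- The part of `(x + y) ^ k` which is odd in `y`. -/
def oddPow (k : ℕ) (x y : ℝ) : ℝ := ((x + y) ^ k - (x - y) ^ k) / 2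

lemma evenPow_succ (k : ℕ) (x y : ℝ) :
    evenPow (k + 1) x y = x * evenPow k x y + y * oddPow k x y := by
  simp only [evenPow, oddPow]; ring

lemma oddPow_succ (k : ℕ) (x y : ℝ) :
    oddPow (k + 1) x y = x * oddPow k x y + y * evenPow k x y := by
  simp only [evenPow, oddPow]; ring

lemma sum_range_pow_mul_succ (g : ℕ → ℝ) (k : ℕ) (x : ℝ) :
    ∑ q ∈ Finset.range (k + 1 + 1), x ^ q * g (k + 1 - q) =
      x * (∑ q ∈ Finset.range (k + 1), x ^ q * g (k - q)) + g (k + 1) := by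
  rw [Finset.sum_range_succ' _ (k + 1), Finset.mul_sum]
  simp only [Nat.add_sub_add_right, pow_succ', Nat.sub_zero, pow_zero, one_mul, mul_assoc]

/-- Unrolling the two-term recursion gives, here and in `oddPow_succ_eq_sum`, the same convolution
that governs the moments of a rank one perturbation, so that the two can be compared term by term.
-/
lemma evenPow_succ_eq_sum (k : ℕ) (x y : ℝ) :
    evenPow (k + 1) x y =
      x ^ (k + 1) + y * ∑ q ∈ Finset.range (k + 1), x ^ q * oddPow (k - q) x y := by
  induction k with
  | zero => simp [evenPow, oddPow]
  | succ k ih =>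
    rw [evenPow_succ, ih, sum_range_pow_mul_succ (fun j => oddPow j x y)]
    ring

lemma oddPow_succ_eq_sum (k : ℕ) (x y : ℝ) :
    oddPow (k + 1) x y = y * ∑ q ∈ Finset.range (k + 1), x ^ q * evenPow (k - q) x y := by
  induction k with
  | zero => simp [evenPow, oddPow]
  | succ k ih =>
    rw [oddPow_succ, ih, sum_range_pow_mul_succ (fun j => evenPow j x y)]
    ring

lemma evenPow_oddPow_nonneg (k : ℕ) {x y : ℝ} (hx : 0 ≤ x) (hy : 0 ≤ y) :
    0 ≤ evenPow k x y ∧ 0 ≤ oddPow k x y := by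
  induction k with
  | zero => simp [evenPow, oddPow]
  | succ k ih =>
    rw [evenPow_succ, oddPow_succ]
    obtain ⟨h1, h2⟩ := ih
    constructor <;> positivity

/-- Monotonicity on `x ≥ 0` makes these functions ordered like the powers of `|l i|`, as Chebyshev's
inequality requires. -/
lemma evenPow_oddPow_mono (k : ℕ) {x x' y : ℝ} (hx : 0 ≤ x) (hxx : x ≤ x') (hy : 0 ≤ y) :
    evenPow k x y ≤ evenPow k x' y ∧ oddPow k x y ≤ oddPow k x' y := by
  induction k with
  | zero => simp [evenPow, oddPow]
  | succ k ih =>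
    simp only [evenPow_succ, oddPow_succ]
    obtain ⟨h1, h2⟩ := ih
    obtain ⟨h3, h4⟩ := evenPow_oddPow_nonneg k hx hy
    constructor <;> gcongr <;> linarith

lemma evenPow_abs {n : ℕ} (hn : Even n) (x y : ℝ) : evenPow n |x| y = evenPow n x y := by
  rcases abs_choice x with h | h <;> rw [h]
  have e1 : -x + y = -(x - y) := by ring
  have e2 : -x - y = -(x + y) := by ring
  rw [evenPow, evenPow, e1, e2, hn.neg_pow, hn.neg_pow, add_comm]

lemma hasDerivAt_evenPow (n : ℕ) (x R t : ℝ) :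
    HasDerivAt (fun t => evenPow n x (R * t)) (n * R * oddPow (n - 1) x (R * t)) t := by
  have h1 : HasDerivAt (fun t => (x + R * t) ^ n) (n * (x + R * t) ^ (n - 1) * R) t := by
    have : HasDerivAt (fun t => x + R * t) R t := by
      simpa using ((hasDerivAt_id t).const_mul R).const_add x
    exact this.fun_pow n
  have h2 : HasDerivAt (fun t => (x - R * t) ^ n) (n * (x - R * t) ^ (n - 1) * (-R)) t := by
    have : HasDerivAt (fun t => x - R * t) (-R) t := by
      simpa using ((hasDerivAt_id t).const_mul R).const_sub x
    exact this.fun_pow n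
  have := (h1.add h2).div_const 2
  refine this.congr_deriv ?_
  simp only [oddPow]; ring

lemma chebyshev_abs_pow {ι : Type*} [Fintype ι] (p l : ι → ℝ) (hp : ∀ i, 0 ≤ p i) (q : ℕ)
    (g : ℝ → ℝ) (hg : ∀ x x', 0 ≤ x → x ≤ x' → g x ≤ g x') :
    (∑ i, p i * |l i| ^ q) * (∑ i, p i * g |l i|) ≤
      (∑ i, p i) * ∑ i, p i * (|l i| ^ q * g |l i|) := by
  refine weighted_chebyshev p (fun i => |l i| ^ q) (fun i => g |l i|) hp fun i j => ?_
  rcases le_total |l i| |l j| with h | h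
  · have h1 := hg _ _ (abs_nonneg _) h
    have h2 := pow_le_pow_left₀ (abs_nonneg (l i)) h q
    nlinarith
  · have h1 := hg _ _ (abs_nonneg _) h
    have h2 := pow_le_pow_left₀ (abs_nonneg (l j)) h q
    nlinarith

/-- Bounds for the even and odd parts of the moments of a rank one perturbation, from the
recursion that these moments satisfy. -/
lemma norm_even_odd_le {ι : Type*} [Fintype ι] (p l : ι → ℝ) (hp : ∀ i, 0 ≤ p i)
    {t : ℝ} (ht : 0 ≤ t) (h v w : ℕ → ℂ)
    (hh : ∀ k, h k = ((∑ i, p i * l i ^ k : ℝ) : ℂ))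
    (hv0 : v 0 = h 0) (hw0 : w 0 = h 0)
    (hv : ∀ k, v (k + 1) = h (k + 1) + t * ∑ q ∈ Finset.range (k + 1), h q * v (k - q))
    (hw : ∀ k, w (k + 1) = h (k + 1) - t * ∑ q ∈ Finset.range (k + 1), h q * w (k - q)) (k : ℕ) :
    ‖(v k + w k) / 2‖ ≤ ∑ i, p i * evenPow k |l i| ((∑ i, p i) * t) ∧
      ‖(v k - w k) / 2‖ ≤ ∑ i, p i * oddPow k |l i| ((∑ i, p i) * t) := by
  have hR : 0 ≤ ∑ i, p i := Finset.sum_nonneg fun i _ => hp i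
  set y := (∑ i, p i) * t with hy
  have hy0 : 0 ≤ y := mul_nonneg hR ht
  have hnorm : ∀ k, ‖h k‖ ≤ ∑ i, p i * |l i| ^ k := by
    intro k
    rw [hh, Complex.norm_real]
    refine (norm_sum_le _ _).trans (Finset.sum_le_sum fun i _ => ?_)
    rw [norm_mul, norm_pow, Real.norm_eq_abs, Real.norm_eq_abs, abs_of_nonneg (hp i)]
  induction k using Nat.strong_induction_on with
  | _ k ih =>
  cases k with
  | zero =>
    rw [hv0, hw0]
    have := hnorm 0
    simp only [evenPow, oddPow]
    simpa using this
  | succ k =>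
    -- The induction step for either parity: Chebyshev bounds a product of two `p`-averages by the
    -- total mass times the average of the product, and the total mass joins `t` to form `y`.
    have key : ∀ (u : ℕ → ℂ) (g : ℕ → ℝ → ℝ),
        (∀ k, ∀ x x', 0 ≤ x → x ≤ x' → g k x ≤ g k x') →
        (∀ j < k + 1, ‖u j‖ ≤ ∑ i, p i * g j |l i|) →
        ‖(t : ℂ) * ∑ q ∈ Finset.range (k + 1), h q * u (k - q)‖ ≤
          ∑ i, p i * (y * ∑ q ∈ Finset.range (k + 1), |l i| ^ q * g (k - q) |l i|) := by
      intro u g hg hu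
      have e : ∑ i, p i * (y * ∑ q ∈ Finset.range (k + 1), |l i| ^ q * g (k - q) |l i|) =
          t * ∑ q ∈ Finset.range (k + 1),
            (∑ i, p i) * ∑ i, p i * (|l i| ^ q * g (k - q) |l i|) := by
        rw [← Finset.mul_sum, Finset.sum_comm, ← mul_assoc, mul_comm t, ← hy, Finset.mul_sum]
        refine Finset.sum_congr rfl fun i _ => ?_
        simp only [Finset.mul_sum]
        refine Finset.sum_congr rfl fun q _ => by ring
      rw [e, norm_mul, Complex.norm_real, Real.norm_eq_abs, abs_of_nonneg ht]
      refine mul_le_mul_of_nonneg_left ((norm_sum_le _ _).trans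
        (Finset.sum_le_sum fun q hq => ?_)) ht
      rw [norm_mul]
      refine (mul_le_mul (hnorm q) (hu (k - q) (by omega)) (norm_nonneg _)
        (Finset.sum_nonneg fun i _ => mul_nonneg (hp i) (by positivity))).trans ?_
      exact chebyshev_abs_pow p l hp q (g (k - q)) (hg _)
    constructor
    -- The coupling has opposite signs in `v` and `w`, so the even part is driven by lower odd
    -- parts, and the odd part by lower even parts.
    · have e : (v (k + 1) + w (k + 1)) / 2 = h (k + 1) +
          t * ∑ q ∈ Finset.range (k + 1), h q * ((v (k - q) - w (k - q)) / 2) := by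
        have : ∀ q, h q * ((v (k - q) - w (k - q)) / 2) =
          (h q * v (k - q)) / 2 - (h q * w (k - q)) / 2 := fun q => by ring
        simp only [this, Finset.sum_sub_distrib, ← Finset.sum_div]
        rw [hv, hw]; ring
      rw [e]
      refine (norm_add_le _ _).trans ?_
      have h2 := key (fun j => (v j - w j) / 2) (fun j x => oddPow j x y)
        (fun j x x' hx hxx => (evenPow_oddPow_mono j hx hxx hy0).2) (fun j hj => (ih j hj).2)
      refine (add_le_add (hnorm _) h2).trans_eq ?_
      rw [← Finset.sum_add_distrib]
      refine Finset.sum_congr rfl fun i _ => ?_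
      rw [evenPow_succ_eq_sum]; ring
    · have e : (v (k + 1) - w (k + 1)) / 2 =
          t * ∑ q ∈ Finset.range (k + 1), h q * ((v (k - q) + w (k - q)) / 2) := by
        have : ∀ q, h q * ((v (k - q) + w (k - q)) / 2) =
          (h q * v (k - q)) / 2 + (h q * w (k - q)) / 2 := fun q => by ring
        simp only [this, Finset.sum_add_distrib, ← Finset.sum_div]
        rw [hv, hw]; ring
      rw [e]
      have h2 := key (fun j => (v j + w j) / 2) (fun j x => evenPow j x y)
        (fun j x x' hx hxx => (evenPow_oddPow_mono j hx hxx hy0).1) (fun j hj => (ih j hj).1)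
      refine h2.trans_eq ?_
      refine Finset.sum_congr rfl fun i _ => ?_
      rw [oddPow_succ_eq_sum]

/-! ### Quadratic forms, spectral weights and traces of powers -/

variable {d : ℕ}

/-- The sesquilinear form `a† M a`. -/
def sesq (M : Matrix (Fin d) (Fin d) ℂ) (a : Fin d → ℂ) : ℂ := star a ⬝ᵥ M.mulVec a

/-- The rank one matrix `a a†`. -/
def rankOne (a : Fin d → ℂ) : Matrix (Fin d) (Fin d) ℂ := Matrix.vecMulVec a (star a)

/-- The weight that `a` gives to the `i`-th eigenvector of `S`. -/
def specWeight {S : Matrix (Fin d) (Fin d) ℂ} (hS : S.IsHermitian) (a : Fin d → ℂ) (i : Fin d) : ℝ :=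
  ‖((star (hS.eigenvectorUnitary : Matrix (Fin d) (Fin d) ℂ)).mulVec a) i‖ ^ 2

lemma specWeight_nonneg {S : Matrix (Fin d) (Fin d) ℂ} (hS : S.IsHermitian) (a : Fin d → ℂ)
    (i : Fin d) : 0 ≤ specWeight hS a i := by unfold specWeight; positivity

lemma spectral_eq {S : Matrix (Fin d) (Fin d) ℂ} (hS : S.IsHermitian) :
    S = (hS.eigenvectorUnitary : Matrix (Fin d) (Fin d) ℂ) *
      Matrix.diagonal (fun i => (hS.eigenvalues i : ℂ)) *
      star (hS.eigenvectorUnitary : Matrix (Fin d) (Fin d) ℂ) := by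
  conv_lhs => rw [hS.spectral_theorem, Unitary.conjStarAlgAut_apply]
  rfl

lemma spectral_pow {S : Matrix (Fin d) (Fin d) ℂ} (hS : S.IsHermitian) (k : ℕ) :
    S ^ k = (hS.eigenvectorUnitary : Matrix (Fin d) (Fin d) ℂ) *
      Matrix.diagonal (fun i => ((hS.eigenvalues i : ℂ)) ^ k) *
      star (hS.eigenvectorUnitary : Matrix (Fin d) (Fin d) ℂ) := by
  have hU : star (hS.eigenvectorUnitary : Matrix (Fin d) (Fin d) ℂ) *
      (hS.eigenvectorUnitary : Matrix (Fin d) (Fin d) ℂ) = 1 := Unitary.coe_star_mul_self _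
  have hU' : (hS.eigenvectorUnitary : Matrix (Fin d) (Fin d) ℂ) *
      star (hS.eigenvectorUnitary : Matrix (Fin d) (Fin d) ℂ) = 1 := Unitary.coe_mul_star_self _
  induction k with
  | zero => simp [hU']
  | succ k ih =>
    rw [pow_succ, ih]
    nth_rewrite 4 [spectral_eq hS]
    simp only [Matrix.mul_assoc]
    rw [← Matrix.mul_assoc (star (hS.eigenvectorUnitary : Matrix (Fin d) (Fin d) ℂ)), hU,
      Matrix.one_mul, ← Matrix.mul_assoc (Matrix.diagonal _), Matrix.diagonal_mul_diagonal]
    simp only [pow_succ]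

lemma trace_pow {S : Matrix (Fin d) (Fin d) ℂ} (hS : S.IsHermitian) (k : ℕ) :
    (S ^ k).trace = ((∑ i, hS.eigenvalues i ^ k : ℝ) : ℂ) := by
  rw [spectral_pow hS, Matrix.trace_mul_comm, ← Matrix.mul_assoc, Unitary.coe_star_mul_self,
    Matrix.one_mul, Matrix.trace_diagonal]
  push_cast; rfl

lemma sesq_conj_diagonal (U : Matrix (Fin d) (Fin d) ℂ) (f : Fin d → ℂ) (a : Fin d → ℂ) :
    sesq (U * Matrix.diagonal f * star U) a = ∑ i, ((‖((star U).mulVec a) i‖ ^ 2 : ℝ) : ℂ) * f i := by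
  have e : star a ⬝ᵥ (U * Matrix.diagonal f * star U).mulVec a =
      star ((star U).mulVec a) ⬝ᵥ (Matrix.diagonal f).mulVec ((star U).mulVec a) := by
    rw [Matrix.star_mulVec, ← Matrix.star_eq_conjTranspose, star_star, Matrix.mulVec_mulVec,
      ← Matrix.dotProduct_mulVec, Matrix.mulVec_mulVec, Matrix.mul_assoc]
  rw [sesq, e, dotProduct]
  refine Finset.sum_congr rfl fun i _ => ?_
  rw [Matrix.mulVec_diagonal, Pi.star_apply, Complex.ofReal_pow, ← Complex.conj_mul',
    mul_left_comm, mul_comm]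
  rfl

lemma sesq_pow {S : Matrix (Fin d) (Fin d) ℂ} (hS : S.IsHermitian) (a : Fin d → ℂ) (k : ℕ) :
    sesq (S ^ k) a = ((∑ i, specWeight hS a i * hS.eigenvalues i ^ k : ℝ) : ℂ) := by
  rw [spectral_pow hS, sesq_conj_diagonal]
  push_cast
  simp [specWeight]

lemma sesq_one (a : Fin d → ℂ) : sesq 1 a = ((∑ i, ‖a i‖ ^ 2 : ℝ) : ℂ) := by
  rw [sesq, Matrix.one_mulVec, dotProduct]
  push_cast
  refine Finset.sum_congr rfl fun i _ => ?_
  rw [← Complex.conj_mul']; rfl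

lemma sum_specWeight {S : Matrix (Fin d) (Fin d) ℂ} (hS : S.IsHermitian) (a : Fin d → ℂ) :
    ∑ i, specWeight hS a i = ∑ i, ‖a i‖ ^ 2 := by
  have h := sesq_pow hS a 0
  rw [pow_zero, sesq_one] at h
  simpa using (Complex.ofReal_injective h).symm

lemma rankOne_isHermitian (a : Fin d → ℂ) : (rankOne a).IsHermitian := by
  rw [rankOne, Matrix.IsHermitian, Matrix.conjTranspose_vecMulVec, star_star]

lemma trace_mul_rankOne (M : Matrix (Fin d) (Fin d) ℂ) (a : Fin d → ℂ) :
    (M * rankOne a).trace = sesq M a := by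
  rw [rankOne, Matrix.mul_vecMulVec, Matrix.trace_vecMulVec, sesq, dotProduct_comm]

lemma sesq_mul_rankOne_mul (M N : Matrix (Fin d) (Fin d) ℂ) (a : Fin d → ℂ) :
    sesq (M * rankOne a * N) a = sesq M a * sesq N a := by
  have h : (rankOne a).mulVec (N.mulVec a) = sesq N a • a := by
    ext i
    simp only [rankOne, Matrix.mulVec, Matrix.vecMulVec_apply, dotProduct, sesq, Pi.smul_apply,
      smul_eq_mul, Finset.sum_mul]
    exact Finset.sum_congr rfl fun j _ => by ring
  rw [sesq, ← Matrix.mulVec_mulVec, ← Matrix.mulVec_mulVec, h, Matrix.mulVec_smul,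
    dotProduct_smul, smul_eq_mul, mul_comm]
  rfl

lemma sesq_add (M N : Matrix (Fin d) (Fin d) ℂ) (a : Fin d → ℂ) :
    sesq (M + N) a = sesq M a + sesq N a := by
  simp [sesq, Matrix.add_mulVec, dotProduct_add]

lemma sesq_smul (c : ℂ) (M : Matrix (Fin d) (Fin d) ℂ) (a : Fin d → ℂ) :
    sesq (c • M) a = c * sesq M a := by
  simp [sesq, Matrix.smul_mulVec, dotProduct_smul]

lemma sesq_sum {ι : Type*} (s : Finset ι) (M : ι → Matrix (Fin d) (Fin d) ℂ) (a : Fin d → ℂ) :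
    sesq (∑ i ∈ s, M i) a = ∑ i ∈ s, sesq (M i) a := by
  classical
  induction s using Finset.induction_on with
  | empty => simp [sesq]
  | insert i s hi ih => rw [Finset.sum_insert hi, Finset.sum_insert hi, sesq_add, ih]

lemma add_pow_succ_eq_sum {A : Type*} [Ring A] (S P : A) (k : ℕ) :
    (S + P) ^ (k + 1) =
      S ^ (k + 1) + ∑ q ∈ Finset.range (k + 1), S ^ q * P * (S + P) ^ (k - q) := by
  induction k with
  | zero => simp
  | succ k ih =>
    rw [pow_succ' (S + P), add_mul, Finset.sum_range_succ' _ (k + 1)]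
    nth_rewrite 1 [ih]
    rw [mul_add, Finset.mul_sum, ← pow_succ']
    simp only [Nat.add_sub_add_right, pow_succ' S, Nat.sub_zero, pow_zero, one_mul, mul_assoc]
    abel

/-- Rank one splits each term `S^q a a† (S + t a a†)^(k-q)` of the telescoping expansion into a
product of two scalars, which closes the recursion. -/
lemma sesq_add_smul_pow_succ (S : Matrix (Fin d) (Fin d) ℂ) (a : Fin d → ℂ) (t : ℂ) (k : ℕ) :
    sesq ((S + t • rankOne a) ^ (k + 1)) a = sesq (S ^ (k + 1)) a +
      t * ∑ q ∈ Finset.range (k + 1),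
        sesq (S ^ q) a * sesq ((S + t • rankOne a) ^ (k - q)) a := by
  rw [add_pow_succ_eq_sum, sesq_add, sesq_sum, Finset.mul_sum]
  congr 1
  refine Finset.sum_congr rfl fun q _ => ?_
  rw [Matrix.mul_smul, Matrix.smul_mul, sesq_smul, sesq_mul_rankOne_mul]

section Derivative

attribute [local instance] Matrix.linftyOpNormedRing Matrix.linftyOpNormedAlgebra

/-- Cyclicity of the trace makes all `n` terms of the Leibniz rule equal, even when `S` and `P` do
not commute. -/
lemma hasDerivAt_trace_pow (S P : Matrix (Fin d) (Fin d) ℂ) (n : ℕ) (t : ℝ) :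
    HasDerivAt (fun t : ℝ => ((S + (t : ℂ) • P) ^ n).trace)
      (n * ((S + (t : ℂ) • P) ^ (n - 1) * P).trace) t := by
  have h1 : HasDerivAt (fun t : ℝ => S + (t : ℂ) • P) P t := by
    have h2 : HasDerivAt (fun t : ℝ => (t : ℂ)) 1 t := Complex.ofRealCLM.hasDerivAt
    exact ((h2.smul_const P).const_add S).congr_deriv (one_smul _ _)
  have h3 := h1.fun_pow' n
  have h4 := ((Matrix.traceLinearMap (Fin d) ℝ ℂ).toContinuousLinearMap.hasFDerivAt).comp_hasDerivAt
    t h3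
  refine h4.congr_deriv ?_
  change Matrix.trace (∑ i ∈ Finset.range n,
    (S + (t : ℂ) • P) ^ (n.pred - i) * P * (S + (t : ℂ) • P) ^ i) = _
  rw [Matrix.trace_sum]
  have h5 : ∀ i ∈ Finset.range n, ((S + (t : ℂ) • P) ^ (n.pred - i) * P * (S + (t : ℂ) • P) ^ i).trace
      = ((S + (t : ℂ) • P) ^ (n - 1) * P).trace := by
    intro i hi
    rw [Matrix.trace_mul_comm, ← Matrix.mul_assoc, ← pow_add]
    congr 3
    have := Finset.mem_range.1 hi
    simp only [Nat.pred_eq_sub_one]; omega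
  rw [Finset.sum_congr rfl h5]
  simp

end Derivative

/-- Both sides are values at `t = 1` of functions of the perturbation strength `t`, up to a
discrepancy fixed at `t = 0`. The derivative of the symmetrized trace is `n` times the odd part of
the moment of order `n - 1`, which `norm_even_odd_le` bounds. -/
lemma rankOne_perturb_trace_pow {S : Matrix (Fin d) (Fin d) ℂ} (hS : S.IsHermitian)
    (a : Fin d → ℂ) (ha : 0 < ∑ i, ‖a i‖ ^ 2) {n : ℕ} (hn : Even n) :
    (((S + rankOne a) ^ n).trace.re + ((S - rankOne a) ^ n).trace.re) / 2 ≤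
      ∑ i, hS.eigenvalues i ^ n + (∑ i, ‖a i‖ ^ 2)⁻¹ * ∑ i, specWeight hS a i *
        (evenPow n (hS.eigenvalues i) (∑ i, ‖a i‖ ^ 2) - hS.eigenvalues i ^ n) := by
  set R := ∑ i, ‖a i‖ ^ 2 with hR
  set p := specWeight hS a with hp
  set l := hS.eigenvalues with hl
  have hpR : ∑ i, p i = R := sum_specWeight hS a
  set W : ℝ → ℝ := fun t => (((S + (t : ℂ) • rankOne a) ^ n).trace.re +
    ((S + ((-t : ℝ) : ℂ) • rankOne a) ^ n).trace.re) / 2 with hW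
  set V : ℝ → ℕ → ℂ := fun t k => sesq ((S + (t : ℂ) • rankOne a) ^ k) a with hV
  have dF : ∀ t : ℝ, HasDerivAt (fun t : ℝ => ((S + (t : ℂ) • rankOne a) ^ n).trace.re)
      ((n : ℂ) * V t (n - 1)).re t := by
    intro t
    have h := hasDerivAt_trace_pow S (rankOne a) n t
    rw [trace_mul_rankOne] at h
    exact Complex.reCLM.hasFDerivAt.comp_hasDerivAt t h
  have dW : ∀ t : ℝ, HasDerivAt W (n * ((V t (n - 1) - V (-t) (n - 1)) / 2).re) t := by
    intro t
    have h2 := (dF (-t)).comp t (hasDerivAt_neg t)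
    refine (((dF t).add h2).div_const 2).congr_deriv ?_
    have e : ∀ z : ℂ, ((n : ℂ) * z).re = n * z.re := fun z => by simp
    have e2 : ∀ z : ℂ, (z / 2).re = z.re / 2 := fun z => by simp
    rw [e, e, e2, Complex.sub_re]; ring
  -- Built so that its derivative is `n` times the bound on the odd part; `R⁻¹` cancels the inner
  -- derivative. The absolute values disappear at the end because `n` is even.
  set Q : ℝ → ℝ := fun t => R⁻¹ * ∑ i, p i * evenPow n |l i| (R * t) with hQ
  have dQ : ∀ t : ℝ, HasDerivAt Q (n * ∑ i, p i * oddPow (n - 1) |l i| (R * t)) t := by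
    intro t
    have h : HasDerivAt Q
        (R⁻¹ * ∑ i, p i * (n * R * oddPow (n - 1) |l i| (R * t))) t :=
      (HasDerivAt.fun_sum fun i (_ : i ∈ Finset.univ) =>
        (hasDerivAt_evenPow n |l i| R t).const_mul (p i)).const_mul R⁻¹
    refine h.congr_deriv ?_
    clear_value R
    rw [Finset.mul_sum, Finset.mul_sum]
    refine Finset.sum_congr rfl fun i _ => ?_
    field_simp
  have hbound : ∀ t : ℝ, 0 ≤ t →
      ((V t (n - 1) - V (-t) (n - 1)) / 2).re ≤ ∑ i, p i * oddPow (n - 1) |l i| (R * t) := by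
    intro t ht
    have h := (norm_even_odd_le p l (specWeight_nonneg hS a) ht (fun k => sesq (S ^ k) a)
      (V t) (V (-t)) (sesq_pow hS a) (by simp [hV]) (by simp [hV])
      (fun k => sesq_add_smul_pow_succ S a t k)
      (fun k => by
        have := sesq_add_smul_pow_succ S a ((-t : ℝ) : ℂ) k
        simp only [hV]
        rw [this]; push_cast; ring) (n - 1)).2
    rw [hpR] at h
    exact (Complex.re_le_norm _).trans h
  have hmono : MonotoneOn (fun t => Q t - W t) (Set.Icc 0 1) := by
    refine monotoneOn_of_deriv_nonneg (convex_Icc 0 1)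
      (fun t _ => ((dQ t).sub (dW t)).continuousAt.continuousWithinAt)
      (fun t _ => ((dQ t).sub (dW t)).differentiableAt.differentiableWithinAt) fun t ht => ?_
    rw [interior_Icc] at ht
    have := ((dQ t).sub (dW t)).deriv
    change 0 ≤ deriv (Q - W) t
    rw [this, ← mul_sub]
    exact mul_nonneg (Nat.cast_nonneg _) (sub_nonneg.2 (hbound t ht.1.le))
  have h01 := hmono (Set.left_mem_Icc.2 zero_le_one) (Set.right_mem_Icc.2 zero_le_one) zero_le_one
  have W0 : W 0 = ∑ i, l i ^ n := by
    simp [hW, trace_pow hS]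
    norm_cast
  have W1 : W 1 = (((S + rankOne a) ^ n).trace.re + ((S - rankOne a) ^ n).trace.re) / 2 := by
    simp [hW, sub_eq_add_neg]
  have Q0 : Q 0 = R⁻¹ * ∑ i, p i * l i ^ n := by
    simp only [hQ, mul_zero]
    congr 1
    refine Finset.sum_congr rfl fun i _ => ?_
    rw [evenPow_abs hn]
    simp [evenPow]
  have Q1 : Q 1 = R⁻¹ * ∑ i, p i * evenPow n (l i) R := by
    simp only [hQ, mul_one]
    congr 1
    refine Finset.sum_congr rfl fun i _ => ?_
    rw [evenPow_abs hn]
  simp only [W0, W1, Q0, Q1] at h01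
  simp only [mul_sub, Finset.sum_sub_distrib]
  linarith

/-! ### The potential `tr cosh (θ S)` -/

/-- The trace of `cosh (θ S)`, as a power series. -/
def traceCosh (θ : ℝ) (S : Matrix (Fin d) (Fin d) ℂ) : ℝ :=
  ∑' k : ℕ, θ ^ (2 * k) / (2 * k).factorial * (S ^ (2 * k)).trace.re

lemma hasSum_cosh_mul (θ x : ℝ) :
    HasSum (fun k : ℕ => θ ^ (2 * k) / (2 * k).factorial * x ^ (2 * k)) (Real.cosh (θ * x)) := by
  have := Real.hasSum_cosh (θ * x)
  refine this.congr_fun fun k => ?_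
  rw [mul_pow]; ring

lemma hasSum_traceCosh (θ : ℝ) {S : Matrix (Fin d) (Fin d) ℂ} (hS : S.IsHermitian) :
    HasSum (fun k : ℕ => θ ^ (2 * k) / (2 * k).factorial * (S ^ (2 * k)).trace.re)
      (∑ i, Real.cosh (θ * hS.eigenvalues i)) := by
  have := hasSum_sum (s := Finset.univ) fun i _ => hasSum_cosh_mul θ (hS.eigenvalues i)
  refine this.congr_fun fun k => ?_
  rw [trace_pow hS, Complex.ofReal_re, Finset.mul_sum]

lemma traceCosh_eq (θ : ℝ) {S : Matrix (Fin d) (Fin d) ℂ} (hS : S.IsHermitian) :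
    traceCosh θ S = ∑ i, Real.cosh (θ * hS.eigenvalues i) := (hasSum_traceCosh θ hS).tsum_eq

/-- A symmetrized rank one perturbation increases the trace of `cosh (θ S)` at most as the
corresponding commuting perturbation does. -/
lemma rankOne_perturb_traceCosh (θ : ℝ) {S : Matrix (Fin d) (Fin d) ℂ} (hS : S.IsHermitian)
    (a : Fin d → ℂ) (ha : 0 < ∑ i, ‖a i‖ ^ 2) :
    (traceCosh θ (S + rankOne a) + traceCosh θ (S - rankOne a)) / 2 ≤
      traceCosh θ S + (∑ i, ‖a i‖ ^ 2)⁻¹ * (Real.cosh (θ * ∑ i, ‖a i‖ ^ 2) - 1) *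
        ∑ i, specWeight hS a i * Real.cosh (θ * hS.eigenvalues i) := by
  set R := ∑ i, ‖a i‖ ^ 2 with hR
  have hp := hS.add (rankOne_isHermitian a)
  have hm := hS.sub (rankOne_isHermitian a)
  have h1 := ((hasSum_traceCosh θ hp).add (hasSum_traceCosh θ hm)).div_const 2
  have h2 : ∀ i, HasSum (fun k : ℕ => θ ^ (2 * k) / (2 * k).factorial *
      (evenPow (2 * k) (hS.eigenvalues i) R - hS.eigenvalues i ^ (2 * k)))
      ((Real.cosh (θ * R) - 1) * Real.cosh (θ * hS.eigenvalues i)) := by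
    intro i
    have := (((hasSum_cosh_mul θ (hS.eigenvalues i + R)).add
      (hasSum_cosh_mul θ (hS.eigenvalues i - R))).div_const 2).sub
      (hasSum_cosh_mul θ (hS.eigenvalues i))
    rw [mul_add, mul_sub, Real.cosh_add, Real.cosh_sub] at this
    have e : (Real.cosh (θ * R) - 1) * Real.cosh (θ * hS.eigenvalues i) =
        (Real.cosh (θ * hS.eigenvalues i) * Real.cosh (θ * R) +
          Real.sinh (θ * hS.eigenvalues i) * Real.sinh (θ * R) +
          (Real.cosh (θ * hS.eigenvalues i) * Real.cosh (θ * R) -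
            Real.sinh (θ * hS.eigenvalues i) * Real.sinh (θ * R))) / 2 -
          Real.cosh (θ * hS.eigenvalues i) := by ring
    rw [e]
    refine this.congr_fun fun k => ?_
    simp only [evenPow]; ring
  have h3 := (hasSum_traceCosh θ hS).add ((hasSum_sum (s := Finset.univ)
    fun i _ => (h2 i).mul_left (specWeight hS a i)).mul_left R⁻¹)
  rw [← traceCosh_eq, ← traceCosh_eq] at h1
  rw [← traceCosh_eq] at h3
  have h4 := hasSum_le (fun k => ?_) h1 h3
  · refine h4.trans_eq ?_
    rw [mul_assoc, Finset.mul_sum _ _ (Real.cosh (θ * R) - 1)]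
    congr 2
    refine Finset.sum_congr rfl fun i _ => by ring
  · have h5 := rankOne_perturb_trace_pow hS a ha (even_two_mul k)
    have h6 : 0 ≤ θ ^ (2 * k) / (2 * k).factorial := by
      have := (even_two_mul k).pow_nonneg θ
      positivity
    rw [← hR] at h5
    have h7 := mul_le_mul_of_nonneg_left h5 h6
    rw [trace_pow hS, Complex.ofReal_re]
    refine (le_of_eq ?_).trans (h7.trans_eq ?_)
    · ring
    · rw [mul_add, mul_left_comm, Finset.mul_sum _ _ (θ ^ (2 * k) / _)]
      congr 2
      rw [Finset.mul_sum]
      refine Finset.sum_congr rfl fun i _ => by ring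

/-! ### Fourth moments of the uniform distribution on the sphere -/

/-- The map of the unit sphere induced by a linear isometry. -/
def sphereMap (e : EuclideanSpace ℂ (Fin d) ≃ₗᵢ[ℂ] EuclideanSpace ℂ (Fin d)) :
    Metric.sphere (0 : EuclideanSpace ℂ (Fin d)) 1 ≃ₜ
      Metric.sphere (0 : EuclideanSpace ℂ (Fin d)) 1 where
  toFun u := ⟨e u.1, by simp⟩
  invFun u := ⟨e.symm u.1, by simp⟩
  left_inv u := by simp
  right_inv u := by simp
  continuous_toFun := by fun_prop
  continuous_invFun := by fun_prop

/-- The uniform probability measure on the unit sphere. -/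
def sphereUniform (d : ℕ) : Measure (Metric.sphere (0 : EuclideanSpace ℂ (Fin d)) 1) :=
  ((volume : Measure (EuclideanSpace ℂ (Fin d))).toSphere Set.univ)⁻¹ •
    (volume : Measure (EuclideanSpace ℂ (Fin d))).toSphere

/-- The measure of a set on the sphere is a multiple of the volume of the cone over it, and an
isometry carries cones to cones of the same volume. -/
lemma measurePreserving_sphereMap
    (e : EuclideanSpace ℂ (Fin d) ≃ₗᵢ[ℂ] EuclideanSpace ℂ (Fin d)) :
    MeasurePreserving (sphereMap e) (sphereUniform d) (sphereUniform d) := by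
  refine MeasurePreserving.smul_measure ⟨(sphereMap e).continuous.measurable, ?_⟩ _
  ext s hs
  let e' : EuclideanSpace ℂ (Fin d) ≃ₗᵢ[ℝ] EuclideanSpace ℂ (Fin d) :=
    ⟨e.toLinearEquiv.restrictScalars ℝ, e.norm_map⟩
  have he' : ∀ x, e' x = e x := fun x => rfl
  have hmp : MeasurePreserving e'.toMeasurableEquiv (volume : Measure (EuclideanSpace ℂ (Fin d)))
    volume := e'.measurePreserving
  rw [Measure.map_apply (sphereMap e).continuous.measurable hs, Measure.toSphere_apply' _ hs,
    Measure.toSphere_apply' _ ((sphereMap e).continuous.measurable hs)]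
  conv_rhs => rw [← hmp.measure_preimage_equiv]
  congr 2
  ext x
  simp only [Set.mem_smul, Set.mem_image, Set.mem_preimage]
  constructor
  · rintro ⟨t, ht, y, ⟨z, hz, rfl⟩, rfl⟩
    refine ⟨t, ht, e z.1, ⟨_, hz, rfl⟩, ?_⟩
    change t • e z.1 = e' (t • z.1)
    rw [map_smul]; rfl
  · rintro ⟨t, ht, y, ⟨z, hz, rfl⟩, hx⟩
    refine ⟨t, ht, e.symm z.1, ⟨⟨e.symm z.1, by simp⟩, ?_, rfl⟩, ?_⟩
    · have : sphereMap e ⟨e.symm z.1, by simp⟩ = z := (sphereMap e).right_inv z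
      rw [this]; exact hz
    · have h2 : e' (t • e.symm z.1) = e' x := by
        rw [map_smul, he', LinearIsometryEquiv.apply_symm_apply]; exact hx
      exact e'.injective h2

lemma isProbabilityMeasure_sphereUniform (hd : 1 ≤ d) : IsProbabilityMeasure (sphereUniform d) := by
  have : Nonempty (Fin d) := ⟨⟨0, hd⟩⟩
  refine ⟨?_⟩
  rw [sphereUniform, Measure.smul_apply, smul_eq_mul]
  refine ENNReal.inv_mul_cancel ?_ (measure_ne_top _ _)
  rw [Ne, Measure.measure_univ_eq_zero]
  exact Measure.toSphere_ne_zero _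

lemma integrable_sphereUniform (hd : 1 ≤ d) {F : Type*} [NormedAddCommGroup F]
    {f : Metric.sphere (0 : EuclideanSpace ℂ (Fin d)) 1 → F}
    (hf : Continuous f) : Integrable f (sphereUniform d) := by
  have := isProbabilityMeasure_sphereUniform hd
  exact hf.integrable_of_hasCompactSupport (HasCompactSupport.of_compactSpace f)

lemma integral_sphereMap {F : Type*} [NormedAddCommGroup F] [NormedSpace ℝ F]
    (e : EuclideanSpace ℂ (Fin d) ≃ₗᵢ[ℂ] EuclideanSpace ℂ (Fin d))
    (f : EuclideanSpace ℂ (Fin d) → F) :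
    ∫ u, f (e u.1) ∂(sphereUniform d) = ∫ u, f u.1 ∂(sphereUniform d) :=
  (measurePreserving_sphereMap e).integral_comp (sphereMap e).measurableEmbedding (fun u => f u.1)

/-- Extending `v` to an orthonormal basis with `v` in place `k` turns the inner product into a
coordinate, and the coordinate map of this basis preserves the measure. -/
lemma integral_inner_pow_four (v : EuclideanSpace ℂ (Fin d)) (hv : ‖v‖ = 1) (k : Fin d) :
    ∫ u, ‖inner ℂ v u.1‖ ^ 4 ∂(sphereUniform d) = ∫ u, ‖u.1 k‖ ^ 4 ∂(sphereUniform d) := by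
  have horth : Orthonormal ℂ (({k} : Set (Fin d)).domRestrict (fun _ => v)) := by
    rw [orthonormal_iff_ite]
    rintro ⟨i, rfl⟩ ⟨j, rfl⟩
    simp [hv, inner_self_eq_norm_sq_to_K]
  obtain ⟨b, hb⟩ := horth.exists_orthonormalBasis_extension_of_card_eq (by simp)
  have hbk := hb k rfl
  rw [← integral_sphereMap b.repr (fun u => ‖u k‖ ^ 4)]
  refine integral_congr_ae (Filter.Eventually.of_forall fun u => ?_)
  simp only [b.repr_apply_apply, hbk]

lemma norm_pow_four_sum (x y : ℂ) :
    ‖x + y‖ ^ 4 + ‖x - y‖ ^ 4 + ‖x + Complex.I * y‖ ^ 4 + ‖x - Complex.I * y‖ ^ 4 =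
      4 * ‖x‖ ^ 4 + 4 * ‖y‖ ^ 4 + 16 * (‖x‖ ^ 2 * ‖y‖ ^ 2) := by
  have h : ∀ z : ℂ, ‖z‖ ^ 2 = z.re ^ 2 + z.im ^ 2 := fun z => by
    rw [← Complex.normSq_eq_norm_sq, Complex.normSq_apply]; ring
  have h4 : ∀ z : ℂ, ‖z‖ ^ 4 = (‖z‖ ^ 2) ^ 2 := fun z => by ring
  simp only [h4, h, Complex.add_re, Complex.add_im, Complex.sub_re, Complex.sub_im, Complex.mul_re,
    Complex.mul_im, Complex.I_re, Complex.I_im]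
  ring

/-- For unimodular `c` the vector `(e_i + c̄ e_j) / √2` is a unit vector, so `|u_i + c u_j|⁴` has
mean `4α`. Summing over `c = ±1, ±i` removes every cross term except `|u_i|² |u_j|²`. -/
lemma integral_sq_mul_sq (hd : 1 ≤ d) {i j : Fin d} (hij : i ≠ j) :
    2 * ∫ u, ‖u.1 i‖ ^ 2 * ‖u.1 j‖ ^ 2 ∂(sphereUniform d) =
      ∫ u, ‖u.1 i‖ ^ 4 ∂(sphereUniform d) := by
  set α := ∫ u, ‖u.1 i‖ ^ 4 ∂(sphereUniform d) with hα
  have hj : ∫ u, ‖u.1 j‖ ^ 4 ∂(sphereUniform d) = α := by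
    have := integral_inner_pow_four (EuclideanSpace.single j (1 : ℂ)) (by simp) i
    simpa [EuclideanSpace.inner_single_left] using this
  have key : ∀ c : ℂ, ‖c‖ = 1 →
      ∫ u, ‖u.1 i + c * u.1 j‖ ^ 4 ∂(sphereUniform d) = 4 * α := by
    intro c hc
    set v : EuclideanSpace ℂ (Fin d) :=
      ((√2 : ℝ) : ℂ)⁻¹ • (EuclideanSpace.single i (1 : ℂ) + EuclideanSpace.single j (star c)) with hv
    have hs : (√2 : ℝ) ^ 2 = 2 := Real.sq_sqrt (by norm_num)
    have hv1 : ‖v‖ = 1 := by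
      have : ‖(EuclideanSpace.single i (1 : ℂ) + EuclideanSpace.single j (star c) :
          EuclideanSpace ℂ (Fin d))‖ ^ 2 = 2 := by
        rw [@norm_add_sq ℂ]
        simp [hc, EuclideanSpace.inner_single_left, hij]
        norm_num
      rw [hv, norm_smul, norm_inv, Complex.norm_real, Real.norm_eq_abs,
        abs_of_nonneg (Real.sqrt_nonneg _), ← Real.sqrt_sq (norm_nonneg (_ + _)), this]
      exact inv_mul_cancel₀ (by positivity)
    have := integral_inner_pow_four v hv1 i
    rw [← hα] at this
    rw [← this, ← integral_const_mul]
    refine integral_congr_ae (Filter.Eventually.of_forall fun u => ?_)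
    have e : inner ℂ v u.1 = ((√2 : ℝ) : ℂ)⁻¹ * (u.1 i + c * u.1 j) := by
      rw [hv, inner_smul_left, inner_add_left]
      simp [EuclideanSpace.inner_single_left]
    simp only [e, norm_mul, norm_inv, Complex.norm_real, Real.norm_eq_abs,
        abs_of_nonneg (Real.sqrt_nonneg _), mul_pow]
    have h4 : (√2 : ℝ)⁻¹ ^ 4 = 1 / 4 := by
      rw [inv_pow, show (√2 : ℝ) ^ 4 = ((√2 : ℝ) ^ 2) ^ 2 by ring, hs]; norm_num
    rw [h4]; ring
  have h1 := key 1 (by simp)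
  have h2 := key (-1) (by simp)
  have h3 := key Complex.I (by simp)
  have h4 := key (-Complex.I) (by simp)
  have hsum : ∫ u, (‖u.1 i + 1 * u.1 j‖ ^ 4 + ‖u.1 i + -1 * u.1 j‖ ^ 4 +
      ‖u.1 i + Complex.I * u.1 j‖ ^ 4 + ‖u.1 i + -Complex.I * u.1 j‖ ^ 4) ∂(sphereUniform d) =
      ∫ u, (4 * ‖u.1 i‖ ^ 4 + 4 * ‖u.1 j‖ ^ 4 + 16 * (‖u.1 i‖ ^ 2 * ‖u.1 j‖ ^ 2))
        ∂(sphereUniform d) := by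
    refine integral_congr_ae (Filter.Eventually.of_forall fun u => ?_)
    simp only [one_mul, neg_mul, ← sub_eq_add_neg]
    exact norm_pow_four_sum _ _
  have hI : ∀ f : Metric.sphere (0 : EuclideanSpace ℂ (Fin d)) 1 → ℝ, Continuous f →
      Integrable f (sphereUniform d) := fun f hf => integrable_sphereUniform hd hf
  rw [integral_add (hI _ (by fun_prop)) (hI _ (by fun_prop)),
    integral_add (hI _ (by fun_prop)) (hI _ (by fun_prop)),
    integral_add (hI _ (by fun_prop)) (hI _ (by fun_prop)),
    integral_add (hI _ (by fun_prop)) (hI _ (by fun_prop)),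
    integral_add (hI _ (by fun_prop)) (hI _ (by fun_prop)),
    h1, h2, h3, h4, integral_const_mul, integral_const_mul, integral_const_mul, hj, ← hα] at hsum
  linarith

/-- The one remaining constant is fixed by integrating `(∑ |u_i|²)² = 1`, which gives `α = 2 /
(d(d+1))`. -/
lemma integral_sq_mul_sq_eq (hd : 1 ≤ d) (i j : Fin d) :
    ∫ u, ‖u.1 i‖ ^ 2 * ‖u.1 j‖ ^ 2 ∂(sphereUniform d) =
      (1 + if i = j then 1 else 0) / (d * (d + 1) : ℝ) := by
  have := isProbabilityMeasure_sphereUniform hd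
  set α := ∫ u, ‖u.1 i‖ ^ 4 ∂(sphereUniform d) with hα
  have hd0 : (0 : ℝ) < d := by exact_mod_cast hd
  have hα' : ∀ k, ∫ u, ‖u.1 k‖ ^ 4 ∂(sphereUniform d) = α := by
    intro k
    have := integral_inner_pow_four (EuclideanSpace.single k (1 : ℂ)) (by simp) i
    simpa [EuclideanSpace.inner_single_left] using this
  have hkl : ∀ k l, ∫ u, ‖u.1 k‖ ^ 2 * ‖u.1 l‖ ^ 2 ∂(sphereUniform d) =
      α / 2 * (1 + if k = l then 1 else 0) := by
    intro k l
    split_ifs with h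
    · subst h
      rw [← hα' k]
      have : ∀ u : Metric.sphere (0 : EuclideanSpace ℂ (Fin d)) 1,
        ‖u.1 k‖ ^ 2 * ‖u.1 k‖ ^ 2 = ‖u.1 k‖ ^ 4 := fun u => by ring
      simp only [this]; ring
    · have := integral_sq_mul_sq hd h
      rw [hα' k] at this
      linarith
  have htot : ∑ k, ∑ l, ∫ u, ‖u.1 k‖ ^ 2 * ‖u.1 l‖ ^ 2 ∂(sphereUniform d) = 1 := by
    have hI : ∀ k l, Integrable (fun u : Metric.sphere (0 : EuclideanSpace ℂ (Fin d)) 1 =>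
      ‖u.1 k‖ ^ 2 * ‖u.1 l‖ ^ 2) (sphereUniform d) := fun k l =>
        integrable_sphereUniform hd (by fun_prop)
    simp only [← integral_finsetSum _ fun l _ => hI _ l]
    rw [← integral_finsetSum _ fun k _ => integrable_finsetSum _ fun l _ => hI k l]
    have : ∀ u : Metric.sphere (0 : EuclideanSpace ℂ (Fin d)) 1,
        ∑ k, ∑ l, ‖u.1 k‖ ^ 2 * ‖u.1 l‖ ^ 2 = 1 := by
      intro u
      rw [← Finset.sum_mul_sum, ← EuclideanSpace.norm_sq_eq, norm_eq_of_mem_sphere]; norm_num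
    simp [this]
  simp only [hkl, ← Finset.mul_sum, Finset.sum_add_distrib] at htot
  simp at htot
  rw [hkl]
  field_simp
  have : α * (d * (d + 1)) = 2 := by linarith
  rw [← this]; ring

lemma sesq_eq_sum_repr {Z : Matrix (Fin d) (Fin d) ℂ} (hZ : Z.IsHermitian)
    (u : EuclideanSpace ℂ (Fin d)) :
    sesq Z u = ((∑ i, ‖(hZ.eigenvectorBasis.repr u) i‖ ^ 2 * hZ.eigenvalues i : ℝ) : ℂ) := by
  have := sesq_pow hZ u 1
  simp only [pow_one] at this
  rw [this]
  congr 1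
  refine Finset.sum_congr rfl fun i _ => ?_
  congr 1
  rw [specWeight, hZ.eigenvectorBasis.repr_apply_apply]
  congr 2
  rw [EuclideanSpace.inner_eq_star_dotProduct, Matrix.mulVec, dotProduct_comm]
  rfl

lemma integral_sesq_sq (hd : 1 ≤ d) {Z : Matrix (Fin d) (Fin d) ℂ} (hZ : Z.IsHermitian) :
    ∫ u, sesq Z u.1 ^ 2 ∂(sphereUniform d) =
      ((((Z ^ 2).trace.re + Z.trace.re ^ 2) / (d * (d + 1)) : ℝ) : ℂ) := by
  have h1 : ∫ u, sesq Z u.1 ^ 2 ∂(sphereUniform d) =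
      ((∫ u, (∑ i, ‖u.1 i‖ ^ 2 * hZ.eigenvalues i) ^ 2 ∂(sphereUniform d) : ℝ) : ℂ) := by
    rw [← integral_sphereMap hZ.eigenvectorBasis.repr
      (fun u => (∑ i, ‖u i‖ ^ 2 * hZ.eigenvalues i) ^ 2), ← integral_complex_ofReal]
    refine integral_congr_ae (Filter.Eventually.of_forall fun u => ?_)
    simp only [sesq_eq_sum_repr hZ]
    push_cast; rfl
  rw [h1]
  congr 1
  have hI : ∀ k l, Integrable (fun u : Metric.sphere (0 : EuclideanSpace ℂ (Fin d)) 1 =>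
      (hZ.eigenvalues k * hZ.eigenvalues l) * (‖u.1 k‖ ^ 2 * ‖u.1 l‖ ^ 2)) (sphereUniform d) :=
    fun k l => integrable_sphereUniform hd (by fun_prop)
  have h2 : ∀ u : Metric.sphere (0 : EuclideanSpace ℂ (Fin d)) 1,
      (∑ i, ‖u.1 i‖ ^ 2 * hZ.eigenvalues i) ^ 2 =
      ∑ k, ∑ l, (hZ.eigenvalues k * hZ.eigenvalues l) * (‖u.1 k‖ ^ 2 * ‖u.1 l‖ ^ 2) := by
    intro u
    rw [sq, Finset.sum_mul_sum]
    exact Finset.sum_congr rfl fun k _ => Finset.sum_congr rfl fun l _ => by ring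
  simp only [h2]
  rw [integral_finsetSum _ fun k _ => integrable_finsetSum _ fun l _ => hI k l]
  simp only [integral_finsetSum _ fun l _ => hI _ l, integral_const_mul,
    integral_sq_mul_sq_eq hd]
  have t1 := trace_pow hZ 1
  rw [pow_one] at t1
  rw [trace_pow hZ, t1, Complex.ofReal_re, Complex.ofReal_re, sq (∑ i, _), Finset.sum_mul_sum,
    add_div, Finset.sum_div, Finset.sum_div, ← Finset.sum_add_distrib]
  refine Finset.sum_congr rfl fun k _ => ?_
  simp only [add_div, mul_add, Finset.sum_add_distrib, ite_div, mul_ite, zero_div, mul_zero,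
    Finset.sum_ite_eq, Finset.mem_univ, if_true, Finset.sum_div]
  rw [add_comm]
  congr 1
  · ring
  · refine Finset.sum_congr rfl fun l _ => by ring

/-! ### Moments of a spherical 2-design -/

lemma quadForm_eq_re_sesq (Z : Matrix (Fin d) (Fin d) ℂ) (a : EuclideanSpace ℂ (Fin d)) :
    quadForm Z a = (sesq Z a).re := by
  rw [quadForm, sesq, dotProduct]
  congr 1
  refine Finset.sum_congr rfl fun i _ => ?_
  rw [Matrix.mulVec, dotProduct, Finset.mul_sum]
  exact Finset.sum_congr rfl fun j _ => mul_assoc _ _ _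

lemma sesq_eq_quadForm {Z : Matrix (Fin d) (Fin d) ℂ} (hZ : Z.IsHermitian)
    (a : EuclideanSpace ℂ (Fin d)) : sesq Z a = (quadForm Z a : ℂ) := by
  rw [quadForm_eq_re_sesq, sesq_eq_sum_repr hZ, Complex.ofReal_re]

lemma sesq_sq_eq_sum (Z : Matrix (Fin d) (Fin d) ℂ) (w : Fin d → ℂ) :
    sesq Z w ^ 2 = ∑ i, ∑ j, ∑ k, ∑ l,
      Z i j * Z k l * ((w j * star (w i)) * (w l * star (w k))) := by
  have h : sesq Z w = ∑ i, ∑ j, Z i j * (w j * star (w i)) := by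
    rw [sesq, dotProduct]
    refine Finset.sum_congr rfl fun i _ => ?_
    rw [Matrix.mulVec, dotProduct, Finset.mul_sum]
    exact Finset.sum_congr rfl fun j _ => by rw [Pi.star_apply]; ring
  rw [sq, h]
  simp only [Finset.sum_mul, Finset.mul_sum]
  refine Finset.sum_congr rfl fun i _ => Finset.sum_congr rfl fun j _ =>
    Finset.sum_congr rfl fun k _ => Finset.sum_congr rfl fun l _ => by ring

section Design

variable {G : Set (EuclideanSpace ℂ (Fin d))} {μ : Measure (EuclideanSpace ℂ (Fin d))}

lemma integrable_of_carried (hG : IsSphericalTwoDesign G μ)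
    {F : Type*} [NormedAddCommGroup F] (f : EuclideanSpace ℂ (Fin d) → F) : Integrable f μ := by
  have := hG.isProbabilityMeasure
  have h : μ.restrict G = μ := Measure.restrict_eq_self_of_ae_mem hG.carried
  rw [← h]
  exact IntegrableOn.of_finite hG.finite

lemma integral_eq_sum_of_carried (hG : IsSphericalTwoDesign G μ) [Fintype G]
    {F : Type*} [NormedAddCommGroup F] [NormedSpace ℝ F] [CompleteSpace F]
    (f : EuclideanSpace ℂ (Fin d) → F) :
    ∫ w, f w ∂μ = ∑ g : G, μ.real {(g : EuclideanSpace ℂ (Fin d))} • f g := by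
  have h : μ.restrict (G.toFinset : Set (EuclideanSpace ℂ (Fin d))) = μ := by
    rw [Set.coe_toFinset]
    exact Measure.restrict_eq_self_of_ae_mem hG.carried
  conv_lhs => rw [← h]
  rw [setIntegral_finset (hf := by rw [IntegrableOn, h]; exact integrable_of_carried hG f)]
  exact (Finset.sum_subtype G.toFinset (by simp)
    (fun g => μ.real {(g : EuclideanSpace ℂ (Fin d))} • f g))

lemma sum_weights (hG : IsSphericalTwoDesign G μ) [Fintype G] :
    ∑ g : G, μ.real {(g : EuclideanSpace ℂ (Fin d))} = 1 := by
  have := hG.isProbabilityMeasure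
  have h := integral_eq_sum_of_carried hG (fun _ => (1 : ℝ))
  simpa using h.symm

lemma integral_sphereUniform_eq_average (f : Metric.sphere (0 : EuclideanSpace ℂ (Fin d)) 1 → ℂ) :
    ∫ u, f u ∂(sphereUniform d) =
      ⨍ u, f u ∂((volume : Measure (EuclideanSpace ℂ (Fin d))).toSphere) := rfl

lemma design_integral_sesq_sq (hd : 1 ≤ d) (hG : IsSphericalTwoDesign G μ)
    (Z : Matrix (Fin d) (Fin d) ℂ) :
    ∫ w, sesq Z w ^ 2 ∂μ = ∫ u, sesq Z u.1 ^ 2 ∂(sphereUniform d) := by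
  have h1 : ∀ i j k l, Integrable (fun w : EuclideanSpace ℂ (Fin d) =>
      Z i j * Z k l * ((w j * star (w i)) * (w l * star (w k)))) μ :=
    fun i j k l => integrable_of_carried hG _
  have h2 : ∀ i j k l, Integrable (fun u : Metric.sphere (0 : EuclideanSpace ℂ (Fin d)) 1 =>
      Z i j * Z k l * ((u.1 j * star (u.1 i)) * (u.1 l * star (u.1 k)))) (sphereUniform d) :=
    fun i j k l => integrable_sphereUniform hd (by fun_prop)
  simp only [sesq_sq_eq_sum]
  rw [integral_finsetSum _ fun i _ => integrable_of_carried hG _,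
    integral_finsetSum _ fun i _ => integrable_finsetSum _ fun j _ => integrable_finsetSum _
      fun k _ => integrable_finsetSum _ fun l _ => h2 i j k l]
  refine Finset.sum_congr rfl fun i _ => ?_
  rw [integral_finsetSum _ fun i _ => integrable_of_carried hG _,
    integral_finsetSum _ fun j _ => integrable_finsetSum _
      fun k _ => integrable_finsetSum _ fun l _ => h2 i j k l]
  refine Finset.sum_congr rfl fun j _ => ?_
  rw [integral_finsetSum _ fun i _ => integrable_of_carried hG _,
    integral_finsetSum _ fun k _ => integrable_finsetSum _ fun l _ => h2 i j k l]
  refine Finset.sum_congr rfl fun k _ => ?_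
  rw [integral_finsetSum _ fun i _ => integrable_of_carried hG _,
    integral_finsetSum _ fun l _ => h2 i j k l]
  refine Finset.sum_congr rfl fun l _ => ?_
  rw [integral_const_mul, integral_const_mul, hG.moment, integral_sphereUniform_eq_average]

lemma design_sum_quadForm_sq (hd : 1 ≤ d) (hG : IsSphericalTwoDesign G μ) [Fintype G]
    {Z : Matrix (Fin d) (Fin d) ℂ} (hZ : Z.IsHermitian) :
    ∑ g : G, μ.real {(g : EuclideanSpace ℂ (Fin d))} * quadForm Z g ^ 2 =
      ((Z ^ 2).trace.re + Z.trace.re ^ 2) / (d * (d + 1)) := by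
  have h := design_integral_sesq_sq hd hG Z
  rw [integral_sesq_sq hd hZ, integral_eq_sum_of_carried hG] at h
  simp only [sesq_eq_quadForm hZ, Complex.real_smul] at h
  exact_mod_cast h

lemma quadForm_one (hG : IsSphericalTwoDesign G μ) (g : G) :
    quadForm 1 (g : EuclideanSpace ℂ (Fin d)) = 1 := by
  rw [quadForm_eq_re_sesq, sesq_one, Complex.ofReal_re, ← EuclideanSpace.norm_sq_eq,
    hG.norm_eq_one _ g.2, one_pow]

/-- A 2-design is also a 1-design: on unit vectors `1` has quadratic form `1`, so the second moment
identities at `Z` and `Z + 1` differ by the first moment. -/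
lemma design_sum_quadForm (hd : 1 ≤ d) (hG : IsSphericalTwoDesign G μ) [Fintype G]
    {Z : Matrix (Fin d) (Fin d) ℂ} (hZ : Z.IsHermitian) :
    ∑ g : G, μ.real {(g : EuclideanSpace ℂ (Fin d))} * quadForm Z g = Z.trace.re / d := by
  have h1 := design_sum_quadForm_sq hd hG hZ
  have h2 := design_sum_quadForm_sq hd hG (hZ.add Matrix.isHermitian_one)
  have hq : ∀ g : G, quadForm (Z + 1) (g : EuclideanSpace ℂ (Fin d)) = quadForm Z g + 1 := by
    intro g
    rw [quadForm_eq_re_sesq, sesq_add, Complex.add_re, ← quadForm_eq_re_sesq,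
      ← quadForm_eq_re_sesq, quadForm_one hG]
  have ht : (Z + 1) ^ 2 = Z ^ 2 + (2 : ℂ) • Z + 1 := by
    rw [two_smul]; noncomm_ring
  have e : ∀ g : G, μ.real {(g : EuclideanSpace ℂ (Fin d))} * (quadForm Z g + 1) ^ 2 =
      μ.real {(g : EuclideanSpace ℂ (Fin d))} * quadForm Z g ^ 2 +
      2 * (μ.real {(g : EuclideanSpace ℂ (Fin d))} * quadForm Z g) +
      μ.real {(g : EuclideanSpace ℂ (Fin d))} := fun g => by ring
  simp only [hq, e, Finset.sum_add_distrib, ← Finset.mul_sum, sum_weights hG, h1, ht,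
    Matrix.trace_add, Matrix.trace_smul, Matrix.trace_one, Complex.add_re, smul_eq_mul] at h2
  have hd0 : (0 : ℝ) < d := by exact_mod_cast hd
  simp at h2
  field_simp at h2 ⊢
  have h3 : (d + 1 : ℝ) * (2 * (d * (∑ g : G, μ.real {(g : EuclideanSpace ℂ (Fin d))} *
    quadForm Z g) - Z.trace.re)) = 0 := by linear_combination h2
  rcases mul_eq_zero.1 h3 with h | h <;> linarith

end Design

lemma quadForm_smul (Z : Matrix (Fin d) (Fin d) ℂ) (c : ℝ) (a : EuclideanSpace ℂ (Fin d)) :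
    quadForm Z (c • a) = c ^ 2 * quadForm Z a := by
  have h : sesq Z (c • a : EuclideanSpace ℂ (Fin d)) = ((c ^ 2 : ℝ) : ℂ) * sesq Z a := by
    simp only [sesq, dotProduct, Matrix.mulVec, Finset.mul_sum]
    refine Finset.sum_congr rfl fun i _ => Finset.sum_congr rfl fun j _ => ?_
    simp
    ring
  rw [quadForm_eq_re_sesq, h, Complex.re_ofReal_mul, ← quadForm_eq_re_sesq]

/-- The common squared norm `√(d(d+1))` of the rescaled vectors. -/
def rescaleSq (d : ℕ) : ℝ := √(d * (d + 1))

lemma rescaleSq_sq (d : ℕ) : rescaleSq d ^ 2 = d * (d + 1) := Real.sq_sqrt (by positivity)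

lemma rescaleSq_pos (hd : 1 ≤ d) : 0 < rescaleSq d := by
  have : (0 : ℝ) < d := by exact_mod_cast hd
  exact Real.sqrt_pos.2 (by positivity)

lemma rescale_factor_sq (d : ℕ) :
    ((((d : ℝ) + 1) * d) ^ (1 / 4 : ℝ)) ^ 2 = rescaleSq d := by
  rw [rescaleSq, Real.sqrt_eq_rpow, ← Real.rpow_natCast, ← Real.rpow_mul (by positivity), mul_comm (d : ℝ)]
  norm_num

lemma quadForm_rescale (Z : Matrix (Fin d) (Fin d) ℂ) (w : EuclideanSpace ℂ (Fin d)) :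
    quadForm Z (rescale w) = rescaleSq d * quadForm Z w := by
  rw [rescale, quadForm_smul, rescale_factor_sq]

lemma sum_norm_sq_rescale {w : EuclideanSpace ℂ (Fin d)} (hw : ‖w‖ = 1) :
    ∑ i, ‖rescale w i‖ ^ 2 = rescaleSq d := by
  rw [← EuclideanSpace.norm_sq_eq, rescale, norm_smul, hw, mul_one, Real.norm_eq_abs, sq_abs,
    rescale_factor_sq]

lemma trace_sq_eq_frobeniusNorm_sq {Z : Matrix (Fin d) (Fin d) ℂ} (hZ : Z.IsHermitian) :
    (Z ^ 2).trace.re = frobeniusNorm Z ^ 2 := by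
  rw [frobeniusNorm, Real.sq_sqrt (by positivity), sq, Matrix.trace, Complex.re_sum]
  refine Finset.sum_congr rfl fun i _ => ?_
  rw [Matrix.diag_apply, Matrix.mul_apply, Complex.re_sum]
  refine Finset.sum_congr rfl fun j _ => ?_
  rw [← hZ.apply i j, ← Complex.normSq_eq_norm_sq, ← hZ.apply j i]
  simp [Complex.normSq_apply]

section Design

variable {G : Set (EuclideanSpace ℂ (Fin d))} {μ : Measure (EuclideanSpace ℂ (Fin d))}

lemma design_sum_rescale_sq (hd : 1 ≤ d) (hG : IsSphericalTwoDesign G μ) [Fintype G]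
    {Z : Matrix (Fin d) (Fin d) ℂ} (hZ : Z.IsHermitian) :
    ∑ g : G, μ.real {(g : EuclideanSpace ℂ (Fin d))} * quadForm Z (rescale g) ^ 2 =
      frobeniusNorm Z ^ 2 + Z.trace.re ^ 2 := by
  have h := design_sum_quadForm_sq hd hG hZ
  simp only [quadForm_rescale, mul_pow, rescaleSq_sq, mul_left_comm _ ((d : ℝ) * (d + 1)),
    ← Finset.mul_sum, h, trace_sq_eq_frobeniusNorm_sq hZ]
  have : (0 : ℝ) < d := by exact_mod_cast hd
  field_simp

lemma design_sum_rescale (hd : 1 ≤ d) (hG : IsSphericalTwoDesign G μ) [Fintype G]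
    {Z : Matrix (Fin d) (Fin d) ℂ} (hZ : Z.IsHermitian) :
    ∑ g : G, μ.real {(g : EuclideanSpace ℂ (Fin d))} * quadForm Z (rescale g) =
      rescaleSq d / d * Z.trace.re := by
  have h := design_sum_quadForm hd hG hZ
  simp only [quadForm_rescale, mul_left_comm _ (rescaleSq d), ← Finset.mul_sum, h]
  ring

end Design

/-! ### Nuclear norm, functions of Hermitian matrices and trace duality -/

/-- Two orthonormal eigenbases of a symmetric operator give the same sum of a function of the
eigenvalues. -/
lemma sum_eigenvalues_eq {E : Type*} [NormedAddCommGroup E] [InnerProductSpace ℂ E]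
    {ι κ : Type*} [Fintype ι] [Fintype κ] (b : OrthonormalBasis ι ℂ E) (v : OrthonormalBasis κ ℂ E)
    {T : E →ₗ[ℂ] E} (hT : T.IsSymmetric) (x : ι → ℝ) (y : κ → ℝ)
    (hb : ∀ i, T (b i) = (x i : ℂ) • b i) (hv : ∀ j, T (v j) = (y j : ℂ) • v j) (f : ℝ → ℝ) :
    ∑ i, f (x i) = ∑ j, f (y j) := by
  -- The overlap vanishes unless `x i = y j`. The squared overlaps form a doubly stochastic array,
  -- so either index can be summed out.
  have h1 : ∀ i j, f (x i) * ‖inner ℂ (b i) (v j)‖ ^ 2 = f (y j) * ‖inner ℂ (b i) (v j)‖ ^ 2 := by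
    intro i j
    by_cases h : inner ℂ (b i) (v j) = 0
    · simp [h]
    · have h2 := hT (b i) (v j)
      rw [hb, hv, inner_smul_left, inner_smul_right, Complex.conj_ofReal] at h2
      rw [Complex.ofReal_injective (mul_right_cancel₀ h h2)]
  calc ∑ i, f (x i) = ∑ i, ∑ j, f (x i) * ‖inner ℂ (b i) (v j)‖ ^ 2 := by
        refine Finset.sum_congr rfl fun i _ => ?_
        rw [← Finset.mul_sum, v.sum_sq_norm_inner_left, b.norm_eq_one]; simp
    _ = ∑ j, ∑ i, f (y j) * ‖inner ℂ (b i) (v j)‖ ^ 2 := by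
        rw [Finset.sum_comm]
        simp only [h1]
    _ = ∑ j, f (y j) := by
        refine Finset.sum_congr rfl fun j _ => ?_
        rw [← Finset.mul_sum, b.sum_sq_norm_inner_right, v.norm_eq_one]; simp

/-- The singular values are square roots of the eigenvalues of `Z† Z = Z²`, and the eigenbasis of
`Z` diagonalizes it with eigenvalues `λ²`; `sum_eigenvalues_eq` makes it unnecessary to match the
orderings. -/
lemma nuclearNorm_eq_sum_abs {Z : Matrix (Fin d) (Fin d) ℂ} (hZ : Z.IsHermitian) :
    nuclearNorm Z = ∑ i, |hZ.eigenvalues i| := by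
  have hT : (Matrix.toEuclideanLin Z).IsSymmetric := Matrix.isSymmetric_toEuclideanLin_iff.mpr hZ
  have hb : ∀ i, Matrix.toEuclideanLin Z (hZ.eigenvectorBasis i) =
      (hZ.eigenvalues i : ℂ) • hZ.eigenvectorBasis i := by
    intro i
    have := hZ.mulVec_eigenvectorBasis i
    rw [Matrix.toLpLin_apply, this]
    rfl
  have hadj : (Matrix.toEuclideanLin Z).adjoint = Matrix.toEuclideanLin Z :=
    (LinearMap.isSymmetric_iff_isSelfAdjoint _).1 hT
  set A := (Matrix.toEuclideanLin Z).adjoint ∘ₗ Matrix.toEuclideanLin Z with hA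
  have hAs : A.IsSymmetric := LinearMap.isSymmetric_adjoint_comp_self _
  have hAb : ∀ i, A (hZ.eigenvectorBasis i) =
      ((hZ.eigenvalues i ^ 2 : ℝ) : ℂ) • hZ.eigenvectorBasis i := by
    intro i
    rw [hA, hadj, LinearMap.comp_apply, hb, map_smul, hb, smul_smul]
    push_cast; rw [sq]
  have h := sum_eigenvalues_eq hZ.eigenvectorBasis
    (hAs.eigenvectorBasis (finrank_euclideanSpace_fin (𝕜 := ℂ) (n := d))) hAs _ _ hAb
    (hAs.apply_eigenvectorBasis (finrank_euclideanSpace_fin (𝕜 := ℂ) (n := d))) Real.sqrt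
  simp only [Real.sqrt_sq_eq_abs] at h
  rw [h, nuclearNorm]
  exact Finset.sum_congr rfl fun i _ =>
    LinearMap.singularValues_fin _ (finrank_euclideanSpace_fin (𝕜 := ℂ) (n := d)) i

/-- A real function applied to the eigenvalues of a Hermitian matrix. -/
def hermFun {X : Matrix (Fin d) (Fin d) ℂ} (hX : X.IsHermitian) (f : ℝ → ℝ) :
    Matrix (Fin d) (Fin d) ℂ :=
  (hX.eigenvectorUnitary : Matrix (Fin d) (Fin d) ℂ) *
      Matrix.diagonal (fun i => (f (hX.eigenvalues i) : ℂ)) *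
      star (hX.eigenvectorUnitary : Matrix (Fin d) (Fin d) ℂ)

lemma hermFun_id {X : Matrix (Fin d) (Fin d) ℂ} (hX : X.IsHermitian) :
    hermFun hX (fun x => x) = X := (spectral_eq hX).symm

lemma hermFun_mul {X : Matrix (Fin d) (Fin d) ℂ} (hX : X.IsHermitian) (f g : ℝ → ℝ) :
    hermFun hX f * hermFun hX g = hermFun hX (fun x => f x * g x) := by
  have hU : star (hX.eigenvectorUnitary : Matrix (Fin d) (Fin d) ℂ) *
      (hX.eigenvectorUnitary : Matrix (Fin d) (Fin d) ℂ) = 1 := Unitary.coe_star_mul_self _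
  simp only [hermFun, Matrix.mul_assoc]
  rw [← Matrix.mul_assoc (star (hX.eigenvectorUnitary : Matrix (Fin d) (Fin d) ℂ)), hU,
      Matrix.one_mul, ← Matrix.mul_assoc (Matrix.diagonal _), Matrix.diagonal_mul_diagonal]
  simp only [Complex.ofReal_mul]

lemma hermFun_isHermitian {X : Matrix (Fin d) (Fin d) ℂ} (hX : X.IsHermitian) (f : ℝ → ℝ) :
    (hermFun hX f).IsHermitian := by
  rw [Matrix.IsHermitian, hermFun, ← Matrix.star_eq_conjTranspose, star_mul, star_mul, star_star,
    Matrix.star_eq_conjTranspose (Matrix.diagonal _), Matrix.diagonal_conjTranspose,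
    Matrix.mul_assoc]
  congr 3
  ext i
  simp

lemma trace_mul_hermFun {X : Matrix (Fin d) (Fin d) ℂ} (hX : X.IsHermitian) (f : ℝ → ℝ)
    (M : Matrix (Fin d) (Fin d) ℂ) :
    (M * hermFun hX f).trace = ∑ i, (f (hX.eigenvalues i) : ℂ) *
      sesq M (fun k => (hX.eigenvectorUnitary : Matrix (Fin d) (Fin d) ℂ) k i) := by
  rw [hermFun, ← Matrix.mul_assoc, Matrix.trace_mul_comm, ← Matrix.mul_assoc, ← Matrix.mul_assoc,
    Matrix.trace]
  refine Finset.sum_congr rfl fun i _ => ?_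
  rw [Matrix.diag_apply, Matrix.mul_diagonal, mul_comm, Matrix.mul_assoc, Matrix.mul_apply]
  rfl

lemma sum_norm_sq_eigenvectorUnitary {X : Matrix (Fin d) (Fin d) ℂ} (hX : X.IsHermitian)
    (i : Fin d) :
    ∑ k, ‖(hX.eigenvectorUnitary : Matrix (Fin d) (Fin d) ℂ) k i‖ ^ 2 = 1 := by
  have hU : star (hX.eigenvectorUnitary : Matrix (Fin d) (Fin d) ℂ) *
      (hX.eigenvectorUnitary : Matrix (Fin d) (Fin d) ℂ) = 1 := Unitary.coe_star_mul_self _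
  have h := congrFun (congrFun hU i) i
  rw [Matrix.one_apply_eq, Matrix.mul_apply] at h
  have h2 : ((∑ k, ‖(hX.eigenvectorUnitary : Matrix (Fin d) (Fin d) ℂ) k i‖ ^ 2 : ℝ) : ℂ) = 1 := by
    rw [← h]
    push_cast
    refine Finset.sum_congr rfl fun k _ => ?_
    rw [← Complex.conj_mul']; rfl
  exact_mod_cast h2

lemma trace_hermFun {X : Matrix (Fin d) (Fin d) ℂ} (hX : X.IsHermitian) (f : ℝ → ℝ) :
    (hermFun hX f).trace = ((∑ i, f (hX.eigenvalues i) : ℝ) : ℂ) := by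
  have := trace_mul_hermFun hX f 1
  rw [Matrix.one_mul] at this
  rw [this]
  simp only [sesq_one, sum_norm_sq_eigenvectorUnitary]
  push_cast
  simp

lemma sesq_hermFun {X : Matrix (Fin d) (Fin d) ℂ} (hX : X.IsHermitian) (f : ℝ → ℝ)
    (a : Fin d → ℂ) :
    sesq (hermFun hX f) a = ((∑ i, specWeight hX a i * f (hX.eigenvalues i) : ℝ) : ℂ) := by
  rw [hermFun, sesq_conj_diagonal]
  push_cast
  simp [specWeight]

lemma sesq_conjTranspose_mul_self (M : Matrix (Fin d) (Fin d) ℂ) (v : Fin d → ℂ) :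
    sesq (M.conjTranspose * M) v = ((∑ i, ‖(M.mulVec v) i‖ ^ 2 : ℝ) : ℂ) := by
  rw [← sesq_one, sesq, sesq, ← Matrix.mulVec_mulVec, Matrix.dotProduct_mulVec,
    Matrix.vecMul_conjTranspose, star_star, Matrix.one_mulVec]

/-- `W` is bounded by `t` in the sense of its numerical range. -/
def NumericallyBounded (W : Matrix (Fin d) (Fin d) ℂ) (t : ℝ) : Prop :=
  ∀ v : Fin d → ℂ, |(sesq W v).re| ≤ t * ∑ i, ‖v i‖ ^ 2

lemma re_trace_mul_le {Z : Matrix (Fin d) (Fin d) ℂ} (hZ : Z.IsHermitian)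
    {W : Matrix (Fin d) (Fin d) ℂ} {t : ℝ} (hW : NumericallyBounded W t) :
    |(W * Z).trace.re| ≤ t * nuclearNorm Z := by
  have h := trace_mul_hermFun hZ (fun x => x) W
  rw [hermFun_id] at h
  rw [h, nuclearNorm_eq_sum_abs hZ, Complex.re_sum, Finset.mul_sum]
  refine (Finset.abs_sum_le_sum_abs _ _).trans (Finset.sum_le_sum fun i _ => ?_)
  rw [Complex.re_ofReal_mul, abs_mul, mul_comm]
  have := hW (fun k => (hZ.eigenvectorUnitary : Matrix (Fin d) (Fin d) ℂ) k i)
  rw [sum_norm_sq_eigenvectorUnitary, mul_one] at this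
  exact mul_le_mul_of_nonneg_right this (abs_nonneg _)

lemma re_sesq_sq_nonneg {M : Matrix (Fin d) (Fin d) ℂ} (hM : M.IsHermitian) (v : Fin d → ℂ) :
    0 ≤ (sesq (M * M) v).re := by
  have h := sesq_conjTranspose_mul_self M v
  rw [hM.eq] at h
  rw [h, Complex.ofReal_re]
  positivity

/-- If `V³ = V`, then `1 - V²` and `(V² + V) / 2` are projections with sum `1 + V`, so `1 + V ≥ 0`.
This applies to `W` and to `-W`. -/
lemma numericallyBounded_of_cube_eq {W : Matrix (Fin d) (Fin d) ℂ} (hW : W.IsHermitian)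
    (h3 : W * W * W = W) : NumericallyBounded W 1 := by
  intro v
  have hE : (W * W).IsHermitian := by
    rw [Matrix.IsHermitian, Matrix.conjTranspose_mul, hW.eq]
  have key : ∀ V : Matrix (Fin d) (Fin d) ℂ, V.IsHermitian → V * V = W * W → V * V * V = V →
      0 ≤ (sesq (1 + V) v).re := by
    intro V hV hVW hV3
    have e : (1 + V : Matrix (Fin d) (Fin d) ℂ) = (1 - V * V) * (1 - V * V) +
        ((1 / 2 : ℝ) : ℂ) • ((V * V + V) * (V * V + V)) := by
      have h4 : V * (V * V) = V := by rw [← Matrix.mul_assoc, hV3]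
      have e1 : (V * V + V) * (V * V + V) = (2 : ℂ) • (V * V + V) := by
        rw [Matrix.mul_add, Matrix.add_mul, Matrix.add_mul, ← Matrix.mul_assoc (V * V), hV3, h4,
          two_smul]
        abel
      have e2 : (1 - V * V) * (1 - V * V) = 1 - V * V := by
        rw [Matrix.mul_sub, Matrix.mul_one, Matrix.sub_mul, Matrix.one_mul,
          ← Matrix.mul_assoc (V * V), hV3, sub_self, sub_zero]
      rw [e1, e2, smul_smul]
      norm_num
      abel
    rw [e, sesq_add, sesq_smul, Complex.add_re, Complex.re_ofReal_mul]
    have h1 := re_sesq_sq_nonneg (M := 1 - V * V) (by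
      rw [hVW]; exact Matrix.isHermitian_one.sub hE) v
    have h2 := re_sesq_sq_nonneg (M := V * V + V) (by
      rw [hVW]; exact hE.add hV) v
    positivity
  have hp := key W hW rfl h3
  have hm := key (-W) hW.neg (by simp) (by simp [h3])
  have hneg : sesq (-W) v = - sesq W v := by
    have := sesq_smul (-1) W v
    simpa using this
  rw [sesq_add, sesq_one, Complex.add_re, Complex.ofReal_re] at hp hm
  rw [hneg, Complex.neg_re] at hm
  rw [abs_le, one_mul]
  constructor <;> linarith

lemma frobeniusNorm_nonneg (A : Matrix (Fin d) (Fin d) ℂ) : 0 ≤ frobeniusNorm A :=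
  Real.sqrt_nonneg _

lemma frobeniusNorm_sq (A : Matrix (Fin d) (Fin d) ℂ) :
    frobeniusNorm A ^ 2 = (A * A.conjTranspose).trace.re := by
  rw [frobeniusNorm, Real.sq_sqrt (by positivity), Matrix.trace, Complex.re_sum]
  refine Finset.sum_congr rfl fun i _ => ?_
  rw [Matrix.diag_apply, Matrix.mul_apply, Complex.re_sum]
  refine Finset.sum_congr rfl fun j _ => ?_
  rw [Matrix.conjTranspose_apply, ← Complex.normSq_eq_norm_sq]
  simp [Complex.normSq_apply]

lemma abs_re_trace_mul_le (A B : Matrix (Fin d) (Fin d) ℂ) :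
    |(A * B).trace.re| ≤ frobeniusNorm A * frobeniusNorm B := by
  refine (Complex.abs_re_le_norm _).trans ?_
  have h1 : ‖(A * B).trace‖ ≤ ∑ x : Fin d × Fin d, ‖A x.1 x.2‖ * ‖B x.2 x.1‖ := by
    rw [Fintype.sum_prod_type, Matrix.trace]
    refine (norm_sum_le _ _).trans (Finset.sum_le_sum fun i _ => ?_)
    rw [Matrix.diag_apply, Matrix.mul_apply]
    refine (norm_sum_le _ _).trans_eq (by simp only [norm_mul])
  refine h1.trans ((Real.sum_mul_le_sqrt_mul_sqrt _ _ _).trans_eq ?_)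
  rw [frobeniusNorm, frobeniusNorm, Fintype.sum_prod_type, Fintype.sum_prod_type]
  congr 2
  exact Finset.sum_comm

/-! ### Signs, range projections and the descent cone -/

/-- The sign of a Hermitian matrix. -/
def matSign {X : Matrix (Fin d) (Fin d) ℂ} (hX : X.IsHermitian) : Matrix (Fin d) (Fin d) ℂ :=
  hermFun hX (fun x => (SignType.sign x : ℝ))

/-- The orthogonal projection onto the range of a Hermitian matrix. -/
def rangeProj {X : Matrix (Fin d) (Fin d) ℂ} (hX : X.IsHermitian) : Matrix (Fin d) (Fin d) ℂ :=
  hermFun hX (fun x => if x = 0 then 0 else 1)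

section Sign

variable {X : Matrix (Fin d) (Fin d) ℂ} (hX : X.IsHermitian)

lemma matSign_mul_self : matSign hX * matSign hX = rangeProj hX := by
  rw [matSign, hermFun_mul, rangeProj]
  congr 1
  ext x
  rcases lt_trichotomy x 0 with h | h | h
  · simp [h, h.ne]
  · simp [h]
  · simp [h, h.ne']

lemma rangeProj_mul_matSign : rangeProj hX * matSign hX = matSign hX := by
  rw [matSign, rangeProj, hermFun_mul]
  congr 1
  ext x
  split_ifs with h <;> simp [h]

lemma matSign_mul_rangeProj : matSign hX * rangeProj hX = matSign hX := by
  rw [matSign, rangeProj, hermFun_mul]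
  congr 1
  ext x
  split_ifs with h <;> simp [h]

lemma rangeProj_mul_rangeProj : rangeProj hX * rangeProj hX = rangeProj hX := by
  rw [rangeProj, hermFun_mul]
  congr 1
  ext x
  split_ifs with h <;> simp

lemma mul_rangeProj : X * rangeProj hX = X := by
  have h := hermFun_mul hX (fun x => x) (fun x => if x = 0 then 0 else 1)
  rw [hermFun_id] at h
  rw [rangeProj, h]
  conv_rhs => rw [← hermFun_id hX]
  congr 1
  ext x
  split_ifs with h <;> simp [h]

/-- With the sign as a right multiple of `X`, any projection that fixes `X` from the left fixes its
sign too. On the kernel the convention `0⁻¹ = 0` gives the right value. -/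
lemma matSign_eq_mul : matSign hX = X * hermFun hX (fun x => |x|⁻¹) := by
  nth_rewrite 2 [← hermFun_id hX]
  rw [matSign, hermFun_mul]
  congr 1
  ext x
  rcases lt_trichotomy x 0 with h | h | h
  · simp [h, abs_of_neg h, h.ne]
  · simp [h]
  · simp [h, abs_of_pos h, h.ne']

lemma trace_mul_matSign : (X * matSign hX).trace.re = nuclearNorm X := by
  nth_rewrite 1 [← hermFun_id hX]
  rw [matSign, hermFun_mul, trace_hermFun, Complex.ofReal_re, nuclearNorm_eq_sum_abs hX]
  refine Finset.sum_congr rfl fun i _ => ?_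
  rw [self_mul_sign]

lemma sum_rangeProj_le {r : ℕ} (hr : X.rank ≤ r) :
    ∑ i, (if hX.eigenvalues i = 0 then (0 : ℝ) else 1) ≤ r := by
  have h : ∑ i, (if hX.eigenvalues i = 0 then (0 : ℝ) else 1) =
      ((Fintype.card {i // hX.eigenvalues i ≠ 0} : ℕ) : ℝ) := by
    rw [Fintype.card_subtype, Finset.card_filter]
    push_cast
    refine Finset.sum_congr rfl fun i _ => ?_
    split_ifs <;> simp_all
  rw [h, ← hX.rank_eq_card_non_zero_eigs]
  exact_mod_cast hr

lemma frobeniusNorm_matSign_le {r : ℕ} (hr : X.rank ≤ r) :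
    frobeniusNorm (matSign hX) ≤ √r := by
  refine Real.le_sqrt_of_sq_le ?_
  have hh : (matSign hX).conjTranspose = matSign hX := (hermFun_isHermitian hX _).eq
  rw [frobeniusNorm_sq, hh, matSign_mul_self, rangeProj,
    trace_hermFun, Complex.ofReal_re]
  exact sum_rangeProj_le hX hr

lemma re_trace_mul_rangeProj_le {r : ℕ} (hr : X.rank ≤ r) {M : Matrix (Fin d) (Fin d) ℂ} {t : ℝ}
    (ht : 0 ≤ t) (hM : ∀ v : Fin d → ℂ, (sesq M v).re ≤ t * ∑ i, ‖v i‖ ^ 2) :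
    (M * rangeProj hX).trace.re ≤ t * r := by
  rw [rangeProj, trace_mul_hermFun, Complex.re_sum]
  refine le_trans ?_ (mul_le_mul_of_nonneg_left (sum_rangeProj_le hX hr) ht)
  rw [Finset.mul_sum]
  refine Finset.sum_le_sum fun i _ => ?_
  have := hM (fun k => (hX.eigenvectorUnitary : Matrix (Fin d) (Fin d) ℂ) k i)
  rw [sum_norm_sq_eigenvectorUnitary] at this
  rw [Complex.re_ofReal_mul, mul_comm t]
  split_ifs with h
  · simp
  · simpa using this

end Sign

lemma NumericallyBounded.re_sesq_sq_le {S : Matrix (Fin d) (Fin d) ℂ} (hS : S.IsHermitian) {t : ℝ}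
    (h : NumericallyBounded S t) (v : Fin d → ℂ) :
    (sesq (S * S) v).re ≤ t ^ 2 * ∑ i, ‖v i‖ ^ 2 := by
  rw [← sq, sesq_pow hS, Complex.ofReal_re, ← sum_specWeight hS, Finset.mul_sum]
  refine Finset.sum_le_sum fun i _ => ?_
  rw [mul_comm]
  refine mul_le_mul_of_nonneg_right ?_ (specWeight_nonneg hS v i)
  refine sq_le_sq' ?_ ?_
  all_goals
    have h1 := h (hS.eigenvectorBasis i)
    have h2 := sesq_eq_sum_repr hS (hS.eigenvectorBasis i)
    rw [h2, Complex.ofReal_re, ← EuclideanSpace.norm_sq_eq, OrthonormalBasis.norm_eq_one] at h1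
    simp [apply_ite, ite_pow] at h1
    have := abs_le.1 h1
    linarith

/-- In the descent cone of the nuclear norm at a matrix of rank at most `r`, the nuclear norm is
controlled by the Frobenius norm; stated by duality with the operator norm. -/
lemma abs_re_trace_mul_le_of_descent {r : ℕ} {X Z : Matrix (Fin d) (Fin d) ℂ} (hX : X.IsHermitian)
    (hZ : Z.IsHermitian) (hr : X.rank ≤ r) (hle : nuclearNorm Z ≤ nuclearNorm X)
    {S : Matrix (Fin d) (Fin d) ℂ} (hS : S.IsHermitian) {t : ℝ} (ht : 0 ≤ t)
    (hSt : NumericallyBounded S t) :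
    |(S * (Z - X)).trace.re| ≤ 3 * √r * t * frobeniusNorm (Z - X) := by
  have hHh : (Z - X).IsHermitian := hZ.sub hX
  have hZe : Z = X + (Z - X) := by abel
  generalize Z - X = H at hHh hZe ⊢
  obtain ⟨E, hE⟩ : ∃ E, E = rangeProj hX := ⟨_, rfl⟩
  obtain ⟨Q, hQ⟩ : ∃ Q, Q = 1 - E := ⟨_, rfl⟩
  have hEh : E.IsHermitian := by rw [hE]; exact hermFun_isHermitian hX _
  have hQh : Q.IsHermitian := by rw [hQ]; exact Matrix.isHermitian_one.sub hEh
  have hEE : E * E = E := by rw [hE]; exact rangeProj_mul_rangeProj hX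
  have hQQ : Q * Q = Q := by
    rw [hQ, Matrix.mul_sub, Matrix.mul_one, Matrix.sub_mul, hEE]; simp
  obtain ⟨K, hK⟩ : ∃ K, K = Q * H * Q := ⟨_, rfl⟩
  have hKh : K.IsHermitian := by
    rw [Matrix.IsHermitian, hK, Matrix.conjTranspose_mul, Matrix.conjTranspose_mul, hQh.eq, hHh.eq,
      Matrix.mul_assoc]
  have hsQ : matSign hX * Q = 0 := by
    rw [hQ, Matrix.mul_sub, hE, matSign_mul_rangeProj]; simp
  have hQs : Q * matSign hX = 0 := by
    rw [hQ, Matrix.sub_mul, hE, rangeProj_mul_matSign]; simp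
  have hXQ : X * Q = 0 := by
    rw [hQ, Matrix.mul_sub, hE, mul_rangeProj]; simp
  have hsh : ∀ {Y : Matrix (Fin d) (Fin d) ℂ} (hY : Y.IsHermitian), (matSign hY).IsHermitian :=
    fun hY => hermFun_isHermitian hY _
  have hQK : Q * K = K := by rw [hK, ← Matrix.mul_assoc, ← Matrix.mul_assoc, hQQ]
  have hQsK : Q * matSign hKh = matSign hKh := by
    rw [matSign_eq_mul hKh, ← Matrix.mul_assoc, hQK]
  have hsKQ : matSign hKh * Q = matSign hKh := by
    have := congrArg Matrix.conjTranspose hQsK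
    rwa [Matrix.conjTranspose_mul, hQh.eq, (hsh hKh).eq] at this
  have h12 : matSign hX * matSign hKh = 0 := by
    rw [← hQsK, ← Matrix.mul_assoc, hsQ, Matrix.zero_mul]
  have h21 : matSign hKh * matSign hX = 0 := by
    rw [← hsKQ, Matrix.mul_assoc, hQs, Matrix.mul_zero]
  -- The dual certificate. The two signs have orthogonal supports, so `W³ = W`, and `‖X‖_* + tr
  -- (sign X · H) + ‖K‖_* = tr (W Z) ≤ ‖Z‖_* ≤ ‖X‖_*`. Hence `‖K‖_* ≤ ‖sign X‖_F ‖H‖_F`.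
  obtain ⟨W, hW⟩ : ∃ W, W = matSign hX + matSign hKh := ⟨_, rfl⟩
  have hWh : W.IsHermitian := by rw [hW]; exact (hsh hX).add (hsh hKh)
  have hW3 : W * W * W = W := by
    have e : W * W = rangeProj hX + rangeProj hKh := by
      rw [hW, Matrix.mul_add, Matrix.add_mul, Matrix.add_mul, h12, h21, matSign_mul_self,
        matSign_mul_self]
      abel
    rw [e, hW, Matrix.mul_add, Matrix.add_mul, Matrix.add_mul, rangeProj_mul_matSign,
      rangeProj_mul_matSign, ← matSign_mul_self hX, ← matSign_mul_self hKh, Matrix.mul_assoc,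
      Matrix.mul_assoc, h12, h21]
    simp
  have hWb := numericallyBounded_of_cube_eq hWh hW3
  have hdual := (le_abs_self _).trans (re_trace_mul_le hZ hWb)
  have hXW : (W * X).trace.re = nuclearNorm X := by
    have e : X * matSign hKh = 0 := by rw [← hQsK, ← Matrix.mul_assoc, hXQ, Matrix.zero_mul]
    rw [Matrix.trace_mul_comm, hW, Matrix.mul_add, e, add_zero, trace_mul_matSign]
  have hHW : (W * H).trace.re = (matSign hX * H).trace.re + nuclearNorm K := by
    have e : (matSign hKh * H).trace = (K * matSign hKh).trace := by
      generalize matSign hKh = T at hQsK hsKQ ⊢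
      calc (T * H).trace = (Q * (T * (Q * H))).trace := by
            rw [← Matrix.mul_assoc T, hsKQ, ← Matrix.mul_assoc Q, hQsK]
        _ = (K * T).trace := by
            rw [Matrix.trace_mul_comm, hK, Matrix.trace_mul_comm _ T]
            simp only [Matrix.mul_assoc]
    rw [hW, Matrix.add_mul, Matrix.trace_add, Complex.add_re, e, trace_mul_matSign]
  have hfrob := frobeniusNorm_nonneg H
  have hKle : nuclearNorm K ≤ √r * frobeniusNorm H := by
    have h1 : (W * Z).trace.re = (W * X).trace.re + (W * H).trace.re := by
      conv_lhs => rw [hZe]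
      rw [Matrix.mul_add, Matrix.trace_add, Complex.add_re]
    rw [h1, hXW, hHW] at hdual
    have h2 := (neg_le_abs _).trans (abs_re_trace_mul_le (matSign hX) H)
    have h3 := mul_le_mul_of_nonneg_right (frobeniusNorm_matSign_le hX hr) hfrob
    linarith
  -- Besides `K`, both pieces contain the projection `E` of rank at most `r`; they pair `H` with `S
  -- E` and `E S Q`, each of Frobenius norm at most `t √r`. The three contributions make the
  -- constant `3`.
  have hdec : H = K + (E * H + Q * H * E) := by
    rw [hK, hQ]; noncomm_ring
  have hsplit : (S * H).trace.re =
      (S * K).trace.re + ((S * E * H).trace.re + (E * S * Q * H).trace.re) := by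
    conv_lhs => rw [hdec]
    rw [Matrix.mul_add, Matrix.mul_add, Matrix.trace_add, Matrix.trace_add, Complex.add_re,
      Complex.add_re]
    congr 2
    · rw [Matrix.mul_assoc]
    · rw [← Matrix.mul_assoc, Matrix.trace_mul_comm]
      simp only [Matrix.mul_assoc]
  have b1 : |(S * K).trace.re| ≤ t * (√r * frobeniusNorm H) :=
    (re_trace_mul_le hKh hSt).trans (mul_le_mul_of_nonneg_left hKle ht)
  have hsqrt : √(t ^ 2 * r) = t * √r := by
    rw [Real.sqrt_mul (by positivity), Real.sqrt_sq ht]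
  have b2 : |(S * E * H).trace.re| ≤ t * √r * frobeniusNorm H := by
    refine (abs_re_trace_mul_le _ _).trans (mul_le_mul_of_nonneg_right ?_ hfrob)
    rw [← hsqrt]
    refine Real.le_sqrt_of_sq_le ?_
    rw [frobeniusNorm_sq, Matrix.conjTranspose_mul, hEh.eq, hS.eq, ← Matrix.mul_assoc,
      Matrix.mul_assoc S, hEE, Matrix.trace_mul_comm, ← Matrix.mul_assoc, hE]
    exact re_trace_mul_rangeProj_le hX hr (by positivity) (hSt.re_sesq_sq_le hS)
  have b3 : |(E * S * Q * H).trace.re| ≤ t * √r * frobeniusNorm H := by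
    refine (abs_re_trace_mul_le _ _).trans (mul_le_mul_of_nonneg_right ?_ hfrob)
    rw [← hsqrt]
    refine Real.le_sqrt_of_sq_le ?_
    have e : E * S * Q * (E * S * Q).conjTranspose = E * (S * Q * S) * E := by
      rw [Matrix.conjTranspose_mul, Matrix.conjTranspose_mul, hEh.eq, hS.eq, hQh.eq,
        Matrix.mul_assoc _ Q, ← Matrix.mul_assoc Q Q, hQQ]
      simp only [Matrix.mul_assoc]
    rw [frobeniusNorm_sq, e, Matrix.trace_mul_comm, ← Matrix.mul_assoc, hEE, Matrix.trace_mul_comm]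
    have hred : (S * Q * S * E).trace.re = (S * Q * S * rangeProj hX).trace.re := by rw [hE]
    rw [hred]
    refine re_trace_mul_rangeProj_le hX hr (by positivity) fun v => ?_
    have e2 : S * Q * S = S * S - (E * S).conjTranspose * (E * S) := by
      rw [Matrix.conjTranspose_mul, hEh.eq, hS.eq, Matrix.mul_assoc S E, ← Matrix.mul_assoc E E,
        hEE, hQ]
      noncomm_ring
    have e3 : sesq (S * S) v = sesq (S * Q * S) v + sesq ((E * S).conjTranspose * (E * S)) v := by
      rw [← sesq_add, e2, sub_add_cancel]
    have h4 := hSt.re_sesq_sq_le hS v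
    rw [e3, Complex.add_re, sesq_conjTranspose_mul_self, Complex.ofReal_re] at h4
    have h5 : 0 ≤ ∑ i, ‖((E * S).mulVec v) i‖ ^ 2 := by positivity
    linarith
  rw [hsplit]
  refine (abs_add_le _ _).trans ?_
  have := abs_add_le (S * E * H).trace.re (E * S * Q * H).trace.re
  nlinarith

/-! ### Finite product expectations and McDiarmid's inequality -/

section FiniteExpectation

variable {γ : Type*} [Fintype γ]

/-- The expectation of `F` for independent samples from the weights `p` on a finite type. -/
def expect (p : γ → ℝ) {m : ℕ} (F : (Fin m → γ) → ℝ) : ℝ := ∑ x, (∏ i, p (x i)) * F x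

lemma expect_zero (p : γ → ℝ) (F : (Fin 0 → γ) → ℝ) : expect p F = F Fin.elim0 := by
  rw [expect, Fintype.sum_unique, Finset.univ_eq_empty, Finset.prod_empty, one_mul]
  congr 1

lemma expect_succ (p : γ → ℝ) {m : ℕ} (F : (Fin (m + 1) → γ) → ℝ) :
    expect p F = ∑ g, p g * expect p (fun x => F (Fin.cons g x : Fin (m + 1) → γ)) := by
  rw [expect, ← (Fin.consEquiv fun _ : Fin (m + 1) => γ).sum_comp, Fintype.sum_prod_type]
  refine Finset.sum_congr rfl fun g _ => ?_
  rw [expect, Finset.mul_sum]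
  refine Finset.sum_congr rfl fun x _ => ?_
  simp only [Fin.consEquiv_apply, Fin.prod_univ_succ, Fin.cons_zero, Fin.cons_succ, mul_assoc]
  rfl

lemma expect_mono {p : γ → ℝ} (hp : ∀ g, 0 ≤ p g) {m : ℕ} {F F' : (Fin m → γ) → ℝ}
    (h : ∀ x, F x ≤ F' x) : expect p F ≤ expect p F' :=
  Finset.sum_le_sum fun x _ =>
    mul_le_mul_of_nonneg_left (h x) (Finset.prod_nonneg fun i _ => hp (x i))

lemma expect_add (p : γ → ℝ) {m : ℕ} (F F' : (Fin m → γ) → ℝ) :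
    expect p (fun x => F x + F' x) = expect p F + expect p F' := by
  simp only [expect, mul_add, Finset.sum_add_distrib]

lemma expect_const_mul (p : γ → ℝ) {m : ℕ} (c : ℝ) (F : (Fin m → γ) → ℝ) :
    expect p (fun x => c * F x) = c * expect p F := by
  simp only [expect, Finset.mul_sum]
  exact Finset.sum_congr rfl fun x _ => by ring

lemma expect_sum (p : γ → ℝ) {m : ℕ} {κ : Type*} (s : Finset κ) (F : κ → (Fin m → γ) → ℝ) :
    expect p (fun x => ∑ k ∈ s, F k x) = ∑ k ∈ s, expect p (F k) := by
  simp only [expect, Finset.mul_sum]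
  exact Finset.sum_comm

lemma expect_const {p : γ → ℝ} (hp : ∑ g, p g = 1) (m : ℕ) (c : ℝ) :
    expect p (fun _ : Fin m → γ => c) = c := by
  induction m with
  | zero => rw [expect_zero]
  | succ m ih => rw [expect_succ, ih, ← Finset.sum_mul, hp, one_mul]

/-- Hoeffding's lemma for a finite weighted average. -/
lemma sum_mul_exp_le {p : γ → ℝ} (hp : ∀ g, 0 ≤ p g) (hp1 : ∑ g, p g = 1) (f : γ → ℝ) {c : ℝ}
    (hf : ∀ g g', f g ≤ f g' + c) (θ : ℝ) :
    ∑ g, p g * Real.exp (θ * f g) ≤ Real.exp (θ * ∑ g, p g * f g + θ ^ 2 * c ^ 2 / 8) := by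
  let _ : MeasurableSpace γ := ⊤
  set ν : Measure γ := ∑ g, ENNReal.ofReal (p g) • Measure.dirac g with hν
  have hint : ∀ F : γ → ℝ, ∫ g, F g ∂ν = ∑ g, p g * F g := by
    intro F
    rw [hν, integral_finsetSum_measure fun g _ =>
      (integrable_dirac (by simp)).smul_measure ENNReal.ofReal_ne_top]
    refine Finset.sum_congr rfl fun g _ => ?_
    rw [integral_smul_measure, integral_dirac, ENNReal.toReal_ofReal (hp g), smul_eq_mul]
  have hprob : IsProbabilityMeasure ν := by
    refine ⟨?_⟩
    rw [hν, Measure.finsetSum_apply]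
    simp only [Measure.smul_apply, measure_univ, smul_eq_mul, mul_one]
    rw [← ENNReal.ofReal_sum_of_nonneg fun g _ => hp g, hp1, ENNReal.ofReal_one]
  have hne : Nonempty γ := by
    by_contra h
    rw [not_nonempty_iff] at h
    simp at hp1
  obtain ⟨g₀, hg₀⟩ := Finite.exists_min f
  have hc : 0 ≤ c := by have := hf g₀ g₀; linarith
  have h := hasSubgaussianMGF_of_mem_Icc (μ := ν) (X := f) (a := f g₀) (b := f g₀ + c)
    (measurable_from_top.aemeasurable) (Filter.Eventually.of_forall fun g => ⟨hg₀ g, hf g g₀⟩)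
  have h2 := h.mgf_le θ
  rw [mgf, hint, hint] at h2
  have e1 : ∑ g, p g * Real.exp (θ * f g) = Real.exp (θ * ∑ g, p g * f g) *
      ∑ g, p g * Real.exp (θ * (f g - ∑ g, p g * f g)) := by
    rw [Finset.mul_sum]
    refine Finset.sum_congr rfl fun g _ => ?_
    rw [mul_left_comm, ← Real.exp_add]
    congr 2; ring
  rw [e1, Real.exp_add]
  refine mul_le_mul_of_nonneg_left (h2.trans_eq ?_) (Real.exp_nonneg _)
  congr 1
  simp only [add_sub_cancel_left, NNReal.coe_pow, NNReal.coe_div, coe_nnnorm, NNReal.coe_ofNat,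
    div_pow, Real.norm_eq_abs, sq_abs]
  ring

/-- **McDiarmid's inequality**, as a bound for the moment generating function. -/
lemma expect_exp_le {p : γ → ℝ} (hp : ∀ g, 0 ≤ p g) (hp1 : ∑ g, p g = 1) {c : ℝ} (θ : ℝ) (m : ℕ)
    (F : (Fin m → γ) → ℝ) (hF : ∀ x i g, F (Function.update x i g) ≤ F x + c) :
    expect p (fun x => Real.exp (θ * F x)) ≤
      Real.exp (θ * expect p F + m * (θ ^ 2 * c ^ 2 / 8)) := by
  induction m with
  | zero => simp [expect_zero]
  | succ m ih =>
    rw [expect_succ, expect_succ]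
    set φ : γ → ℝ := fun g => expect p (fun x => F (Fin.cons g x : Fin (m + 1) → γ)) with hφ
    have h1 : ∀ g, expect p (fun x => Real.exp (θ * F (Fin.cons g x : Fin (m + 1) → γ))) ≤
        Real.exp (θ * φ g) * Real.exp (m * (θ ^ 2 * c ^ 2 / 8)) := by
      intro g
      rw [← Real.exp_add]
      refine ih (fun x => F (Fin.cons g x : Fin (m + 1) → γ)) fun x i h => ?_
      rw [Fin.cons_update]
      exact hF _ _ _
    -- Averaging out the other coordinates keeps the bounded difference in the first one, so
    -- Hoeffding's lemma applies to `φ`.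
    have h2 : ∀ g g', φ g ≤ φ g' + c := by
      intro g g'
      have h3 : φ g' + c = expect p (fun x => F (Fin.cons g' x : Fin (m + 1) → γ) + c) := by
        rw [expect_add, expect_const hp1]
      rw [h3]
      refine expect_mono hp fun x => ?_
      have := hF (Fin.cons g' x : Fin (m + 1) → γ) 0 g
      rwa [Fin.update_cons_zero] at this
    calc ∑ g, p g * expect p (fun x => Real.exp (θ * F (Fin.cons g x : Fin (m + 1) → γ)))
        ≤ ∑ g, p g * (Real.exp (θ * φ g) * Real.exp (m * (θ ^ 2 * c ^ 2 / 8))) :=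
          Finset.sum_le_sum fun g _ => mul_le_mul_of_nonneg_left (h1 g) (hp g)
      _ = (∑ g, p g * Real.exp (θ * φ g)) * Real.exp (m * (θ ^ 2 * c ^ 2 / 8)) := by
          rw [Finset.sum_mul]; exact Finset.sum_congr rfl fun g _ => by ring
      _ ≤ Real.exp (θ * ∑ g, p g * φ g + θ ^ 2 * c ^ 2 / 8) *
            Real.exp (m * (θ ^ 2 * c ^ 2 / 8)) :=
          mul_le_mul_of_nonneg_right (sum_mul_exp_le hp hp1 φ h2 θ) (Real.exp_nonneg _)
      _ = _ := by
          rw [← Real.exp_add]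
          congr 1
          push_cast; ring

/-- **McDiarmid's inequality**. -/
lemma mcdiarmid {p : γ → ℝ} (hp : ∀ g, 0 ≤ p g) (hp1 : ∑ g, p g = 1) {c : ℝ} (hc : 0 < c) {m : ℕ}
    (hm : 0 < m) (F : (Fin m → γ) → ℝ) (hF : ∀ x i g, F (Function.update x i g) ≤ F x + c)
    {t : ℝ} (ht : 0 ≤ t) :
    expect p (Set.indicator {x | expect p F + t ≤ F x} 1) ≤ Real.exp (-2 * t ^ 2 / (m * c ^ 2)) := by
  have hm0 : (0 : ℝ) < m := by exact_mod_cast hm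
  -- The minimizer of the Chernoff exponent `-θ t + m θ² c² / 8`.
  set θ := 4 * t / (m * c ^ 2) with hθ
  have hθ0 : 0 ≤ θ := by positivity
  have h1 : expect p (Set.indicator {x | expect p F + t ≤ F x} 1) ≤
      expect p (fun x => Real.exp (-(θ * (expect p F + t))) * Real.exp (θ * F x)) := by
    refine expect_mono hp fun x => ?_
    rw [← Real.exp_add]
    by_cases hx : x ∈ {x | expect p F + t ≤ F x}
    · rw [Set.indicator_of_mem hx, Pi.one_apply, Real.one_le_exp_iff]
      have := mul_le_mul_of_nonneg_left hx hθ0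
      linarith
    · rw [Set.indicator_of_notMem hx]
      exact Real.exp_nonneg _
  rw [expect_const_mul] at h1
  refine h1.trans ((mul_le_mul_of_nonneg_left (expect_exp_le hp hp1 θ m F hF)
    (Real.exp_nonneg _)).trans_eq ?_)
  rw [← Real.exp_add]
  congr 1
  rw [hθ]
  field_simp
  ring

end FiniteExpectation

/-! ### Symmetrization and contraction -/

section Symmetrization

variable {γ κ : Type*} [Fintype γ]

lemma bddAbove_add_of_le {κ : Type*} {u v : κ → ℝ} {b : ℝ} (hu : BddAbove (Set.range u)) (hv : ∀ k, v k ≤ b) :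
    BddAbove (Set.range fun k => u k + v k) := by
  obtain ⟨B, hB⟩ := hu
  refine ⟨B + b, ?_⟩
  rintro _ ⟨k, rfl⟩
  exact add_le_add (hB ⟨k, rfl⟩) (hv k)

/-- Symmetrization and contraction in one coordinate. -/
lemma sum_iSup_centered_abs_le [Nonempty κ] {p : γ → ℝ} (hp : ∀ g, 0 ≤ p g) (hp1 : ∑ g, p g = 1)
    (f : κ → γ → ℝ) {b : ℝ} (hf : ∀ k g, |f k g| ≤ b) (u : κ → ℝ) (hu : BddAbove (Set.range u)) :
    ∑ g, p g * ⨆ k, (u k + (∑ g', p g' * |f k g'| - |f k g|)) ≤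
      ∑ g, p g * (((⨆ k, (u k + 2 * f k g)) + ⨆ k, (u k + -2 * f k g)) / 2) := by
  set B : γ → ℝ := fun g => ((⨆ k, (u k + 2 * f k g)) + ⨆ k, (u k + -2 * f k g)) / 2 with hB
  set A : γ → γ → ℝ := fun g' g => ⨆ k, (u k + (|f k g'| - |f k g|)) with hA
  have bA : ∀ g' g, BddAbove (Set.range fun k => u k + (|f k g'| - |f k g|)) := fun g' g =>
    bddAbove_add_of_le (b := b) hu fun k => by
      have := hf k g'; have := abs_nonneg (f k g); linarith
  have bp : ∀ g, BddAbove (Set.range fun k => u k + 2 * f k g) := fun g =>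
    bddAbove_add_of_le (b := 2 * b) hu fun k => by
      have := (le_abs_self _).trans (hf k g); linarith
  have bm : ∀ g, BddAbove (Set.range fun k => u k + -2 * f k g) := fun g =>
    bddAbove_add_of_le (b := 2 * b) hu fun k => by
      have := (neg_le_abs _).trans (hf k g); linarith
  -- The mean is an average over an independent copy `g'`, and the supremum of an average is at most
  -- the average of the suprema.
  have h1 : ∀ g, ⨆ k, (u k + (∑ g', p g' * |f k g'| - |f k g|)) ≤ ∑ g', p g' * A g' g := by
    intro g
    refine ciSup_le fun k => ?_
    have e : u k + (∑ g', p g' * |f k g'| - |f k g|) =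
        ∑ g', p g' * (u k + (|f k g'| - |f k g|)) := by
      simp only [mul_add, mul_sub, Finset.sum_add_distrib, Finset.sum_sub_distrib, ← Finset.sum_mul,
        hp1, one_mul]
    rw [e]
    exact Finset.sum_le_sum fun g' _ => mul_le_mul_of_nonneg_left (le_ciSup (bA g' g) k) (hp g')
  -- Contraction: exchanging `g` and `g'` produces two suprema, which are merged. Then `|f k| - |f
  -- l| ≤ |f k - f l|`, and either sign of `f k - f l` is covered by the two suprema in `B`.
  have h2 : ∀ g g', A g' g + A g g' ≤ B g + B g' := by
    intro g g'
    refine ciSup_add_ciSup_le fun k l => ?_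
    have key : ∀ g k l, (u k + u l) / 2 + (|f k g| - |f l g|) ≤ B g := by
      intro g k l
      have a1 := le_ciSup (bp g) k
      have a2 := le_ciSup (bm g) k
      have a3 := le_ciSup (bp g) l
      have a4 := le_ciSup (bm g) l
      have a5 := abs_sub_abs_le_abs_sub (f k g) (f l g)
      simp only [hB] at *
      rcases abs_choice (f k g - f l g) with h | h <;> rw [h] at a5 <;> linarith
    have k1 := key g' k l
    have k2 := key g l k
    linarith
  calc ∑ g, p g * ⨆ k, (u k + (∑ g', p g' * |f k g'| - |f k g|))
      ≤ ∑ g, p g * ∑ g', p g' * A g' g :=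
        Finset.sum_le_sum fun g _ => mul_le_mul_of_nonneg_left (h1 g) (hp g)
    _ = ∑ g, ∑ g', p g * p g' * ((A g' g + A g g') / 2) := by
        have e1 : ∑ g, p g * ∑ g', p g' * A g' g = ∑ g, ∑ g', p g * p g' * A g' g := by
          simp only [Finset.mul_sum, mul_assoc]
        have e2 : ∑ g, ∑ g', p g * p g' * A g' g = ∑ g, ∑ g', p g * p g' * A g g' := by
          rw [Finset.sum_comm]
          simp only [mul_comm (p _) (p _)]
        have e3 : ∀ g g', p g * p g' * ((A g' g + A g g') / 2) =
          (p g * p g' * A g' g + p g * p g' * A g g') / 2 := fun g g' => by ring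
        simp only [e3, ← Finset.sum_div, Finset.sum_add_distrib]
        rw [← e2, e1]; ring
    _ ≤ ∑ g, ∑ g', p g * p g' * ((B g + B g') / 2) := by
        refine Finset.sum_le_sum fun g _ => Finset.sum_le_sum fun g' _ =>
          mul_le_mul_of_nonneg_left ?_ (mul_nonneg (hp g) (hp g'))
        have := h2 g g'
        linarith
    _ = ∑ g, p g * B g := by
        have e3 : ∀ g g', p g * p g' * ((B g + B g') / 2) =
          (p g * B g) * p g' / 2 + p g * (p g' * B g') / 2 := fun g g' => by ring
        simp only [e3, Finset.sum_add_distrib, ← Finset.sum_div, ← Finset.mul_sum, hp1, mul_one,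
          ← Finset.sum_mul, one_mul]
        ring

/-- The sign of a boolean. -/
def boolSign (s : Bool) : ℝ := if s then 1 else -1

/-- The weights of a sample with an independent random sign. -/
def signedWeight (p : γ → ℝ) (y : γ × Bool) : ℝ := p y.1 / 2

lemma signedWeight_nonneg {γ : Type*} {p : γ → ℝ} (hp : ∀ g, 0 ≤ p g) (y : γ × Bool) :
    0 ≤ signedWeight p y := div_nonneg (hp _) zero_le_two

lemma sum_signedWeight {p : γ → ℝ} (hp1 : ∑ g, p g = 1) : ∑ y, signedWeight p y = 1 := by
  rw [Fintype.sum_prod_type]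
  have h : ∀ g, 2 * (p g / 2) = p g := fun g => by ring
  simp [signedWeight, h, hp1]

lemma sum_signedWeight_mul (p : γ → ℝ) (F : γ × Bool → ℝ) :
    ∑ y, signedWeight p y * F y = ∑ g, p g * ((F (g, true) + F (g, false)) / 2) := by
  rw [Fintype.sum_prod_type]
  refine Finset.sum_congr rfl fun g _ => ?_
  simp only [Fintype.sum_bool, signedWeight]
  ring

/-- Symmetrization and contraction. -/
lemma expect_iSup_centered_abs_le [Nonempty κ] {p : γ → ℝ} (hp : ∀ g, 0 ≤ p g) (hp1 : ∑ g, p g = 1)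
    (f : κ → γ → ℝ) {b : ℝ} (hf : ∀ k g, |f k g| ≤ b) (m : ℕ) (u : κ → ℝ)
    (hu : BddAbove (Set.range u)) :
    expect p (fun x : Fin m → γ => ⨆ k, (u k + ∑ i, (∑ g', p g' * |f k g'| - |f k (x i)|))) ≤
      expect (signedWeight p) (fun y : Fin m → γ × Bool =>
        ⨆ k, (u k + ∑ i, 2 * (boolSign (y i).2 * f k (y i).1))) := by
  induction m generalizing u with
  | zero => simp [expect_zero]
  | succ m ih =>
    have hM : ∀ k, ∑ g', p g' * |f k g'| ≤ b := fun k =>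
      (Finset.sum_le_sum fun g _ => mul_le_mul_of_nonneg_left (hf k g) (hp g)).trans_eq
        (by rw [← Finset.sum_mul, hp1, one_mul])
    rw [expect_succ]
    simp only [Fin.sum_univ_succ, Fin.cons_zero, Fin.cons_succ, ← add_assoc (u _)]
    -- The arbitrary offset `u` drives the induction: it absorbs the first coordinate while the
    -- others are symmetrized, and then the others while the first is.
    calc _ ≤ ∑ g, p g * expect (signedWeight p) (fun y : Fin m → γ × Bool =>
            ⨆ k, (u k + (∑ g', p g' * |f k g'| - |f k g|) +
              ∑ i, 2 * (boolSign (y i).2 * f k (y i).1))) := by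
          refine Finset.sum_le_sum fun g _ => mul_le_mul_of_nonneg_left
            (ih _ (bddAbove_add_of_le (b := b) hu fun k => ?_)) (hp g)
          have := hM k; have := abs_nonneg (f k g); linarith
      _ = expect (signedWeight p) (fun y : Fin m → γ × Bool => ∑ g, p g *
            ⨆ k, ((u k + ∑ i, 2 * (boolSign (y i).2 * f k (y i).1)) +
              (∑ g', p g' * |f k g'| - |f k g|))) := by
          rw [expect_sum]
          simp only [expect_const_mul, add_right_comm]
      _ ≤ expect (signedWeight p) (fun y : Fin m → γ × Bool => ∑ g, p g *
            (((⨆ k, ((u k + ∑ i, 2 * (boolSign (y i).2 * f k (y i).1)) + 2 * f k g)) +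
            ⨆ k, ((u k + ∑ i, 2 * (boolSign (y i).2 * f k (y i).1)) + -2 * f k g)) / 2)) := by
          refine expect_mono (signedWeight_nonneg hp) fun y =>
            sum_iSup_centered_abs_le hp hp1 f hf _
              (bddAbove_add_of_le (b := ∑ _i : Fin m, 2 * b) hu fun k =>
                Finset.sum_le_sum fun i _ => ?_)
          have h1 := abs_le.1 (hf k (y i).1)
          unfold boolSign
          split_ifs <;> linarith [h1.1, h1.2]
      _ = _ := by
          rw [expect_succ, sum_signedWeight_mul, expect_sum]
          refine Finset.sum_congr rfl fun g _ => ?_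
          rw [expect_const_mul]
          congr 1
          simp only [div_eq_inv_mul]
          rw [expect_const_mul, expect_add]
          have ht : boolSign true = 1 := rfl
          have hf : boolSign false = -1 := rfl
          simp only [Fin.cons_zero, Fin.cons_succ, ht, hf, one_mul, neg_mul, mul_neg,
            add_right_comm]

end Symmetrization

/-! ### Expected operator norm of the signed sum -/

section SignedSum

variable {γ : Type*}

/-- The signed sum of the rank one matrices of a sample. -/
def signedSum (A : γ → Fin d → ℂ) {m : ℕ} (y : Fin m → γ × Bool) : Matrix (Fin d) (Fin d) ℂ :=
  ∑ i, (boolSign (y i).2 : ℂ) • rankOne (A (y i).1)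

lemma signedSum_isHermitian (A : γ → Fin d → ℂ) {m : ℕ} (y : Fin m → γ × Bool) :
    (signedSum A y).IsHermitian := by
  rw [signedSum, Matrix.IsHermitian, Matrix.conjTranspose_sum]
  refine Finset.sum_congr rfl fun i _ => ?_
  rw [Matrix.conjTranspose_smul, (rankOne_isHermitian _).eq]
  simp

lemma trace_signedSum_mul (A : γ → Fin d → ℂ) {m : ℕ} (y : Fin m → γ × Bool)
    (H : Matrix (Fin d) (Fin d) ℂ) :
    (signedSum A y * H).trace.re = ∑ i, boolSign (y i).2 * (sesq H (A (y i).1)).re := by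
  rw [Matrix.trace_mul_comm, signedSum, Matrix.mul_sum, Matrix.trace_sum, Complex.re_sum]
  refine Finset.sum_congr rfl fun i _ => ?_
  rw [Matrix.mul_smul, Matrix.trace_smul, trace_mul_rankOne, smul_eq_mul, Complex.re_ofReal_mul]

lemma traceCosh_zero (θ : ℝ) : traceCosh θ (0 : Matrix (Fin d) (Fin d) ℂ) = d := by
  rw [traceCosh, tsum_eq_single 0]
  · simp
  · intro k hk
    rw [zero_pow (by omega)]
    simp

lemma le_traceCosh (θ : ℝ) {S : Matrix (Fin d) (Fin d) ℂ} (hS : S.IsHermitian) (i : Fin d) :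
    Real.cosh (θ * hS.eigenvalues i) ≤ traceCosh θ S := by
  rw [traceCosh_eq θ hS]
  exact Finset.single_le_sum (f := fun i => Real.cosh (θ * hS.eigenvalues i))
    (fun j _ => (Real.cosh_pos _).le) (Finset.mem_univ i)

lemma one_le_traceCosh (hd : 1 ≤ d) (θ : ℝ) {S : Matrix (Fin d) (Fin d) ℂ} (hS : S.IsHermitian) :
    1 ≤ traceCosh θ S := (Real.one_le_cosh _).trans (le_traceCosh θ hS ⟨0, hd⟩)

/-- Each eigenvalue satisfies `exp (θ |λ|) ≤ 2 cosh (θ λ) ≤ 2 tr cosh (θ S)`. -/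
lemma numericallyBounded_log_traceCosh {θ : ℝ} (hθ : 0 < θ) {S : Matrix (Fin d) (Fin d) ℂ}
    (hS : S.IsHermitian) : NumericallyBounded S (Real.log (2 * traceCosh θ S) / θ) := by
  have h1 : ∀ i, |hS.eigenvalues i| ≤ Real.log (2 * traceCosh θ S) / θ := by
    intro i
    rw [le_div_iff₀ hθ]
    have h2 := le_traceCosh θ hS i
    have h3 : 0 < traceCosh θ S := (Real.cosh_pos _).trans_le h2
    rw [Real.le_log_iff_exp_le (by positivity)]
    rw [← Real.cosh_abs, abs_mul, abs_of_pos hθ, Real.cosh_eq] at h2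
    have h4 := Real.exp_pos (-(θ * |hS.eigenvalues i|))
    rw [mul_comm]
    linarith
  intro v
  have h2 := sesq_pow hS v 1
  simp only [pow_one] at h2
  rw [h2, Complex.ofReal_re, ← sum_specWeight hS, Finset.mul_sum]
  refine (Finset.abs_sum_le_sum_abs _ _).trans (Finset.sum_le_sum fun i _ => ?_)
  rw [abs_mul, abs_of_nonneg (specWeight_nonneg hS v i), mul_comm]
  exact mul_le_mul_of_nonneg_right (h1 i) (specWeight_nonneg hS v i)

variable [Fintype γ]

lemma expect_traceCosh_le {p : γ → ℝ} (hp : ∀ g, 0 ≤ p g) (A : γ → Fin d → ℂ)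
    {R c : ℝ} (hR : 0 < R) (hAR : ∀ g, ∑ i, ‖A g i‖ ^ 2 = R)
    (hA : ∀ Z : Matrix (Fin d) (Fin d) ℂ, Z.IsHermitian →
      ∑ g, p g * (sesq Z (A g)).re = c * Z.trace.re) (hp1 : ∑ g, p g = 1) (θ : ℝ) (m : ℕ)
    {S : Matrix (Fin d) (Fin d) ℂ} (hS : S.IsHermitian) :
    expect (signedWeight p) (fun y : Fin m → γ × Bool => traceCosh θ (S + signedSum A y)) ≤
      traceCosh θ S * (1 + c / R * (Real.cosh (θ * R) - 1)) ^ m := by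
  have hstep : ∀ {S : Matrix (Fin d) (Fin d) ℂ} (hS : S.IsHermitian),
      ∑ g, p g * ((traceCosh θ (S + rankOne (A g)) + traceCosh θ (S - rankOne (A g))) / 2) ≤
        traceCosh θ S * (1 + c / R * (Real.cosh (θ * R) - 1)) := by
    intro S hS
    -- The increment is the quadratic form of `cosh (θ S)` at the sampled vector, so isotropy (`hA`)
    -- averages it to a multiple of the potential itself.
    calc _ ≤ ∑ g, p g * (traceCosh θ S + R⁻¹ * (Real.cosh (θ * R) - 1) *
            (sesq (hermFun hS (fun x => Real.cosh (θ * x))) (A g)).re) := by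
          refine Finset.sum_le_sum fun g _ => mul_le_mul_of_nonneg_left ?_ (hp g)
          have := rankOne_perturb_traceCosh θ hS (A g) (by rw [hAR]; exact hR)
          rwa [hAR, ← Complex.ofReal_re (∑ i, specWeight hS (A g) i * _), ← sesq_hermFun hS
            (fun x => Real.cosh (θ * x))] at this
      _ = _ := by
          have e : ∀ g, p g * (traceCosh θ S + R⁻¹ * (Real.cosh (θ * R) - 1) *
            (sesq (hermFun hS (fun x => Real.cosh (θ * x))) (A g)).re) =
            p g * traceCosh θ S + R⁻¹ * (Real.cosh (θ * R) - 1) * (p g *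
            (sesq (hermFun hS (fun x => Real.cosh (θ * x))) (A g)).re) := fun g => by ring
          simp only [e, Finset.sum_add_distrib, ← Finset.sum_mul, ← Finset.mul_sum, hp1]
          rw [hA _ (hermFun_isHermitian hS _), trace_hermFun, Complex.ofReal_re, ← traceCosh_eq]
          ring
  have hstep0 : ∀ {S : Matrix (Fin d) (Fin d) ℂ} (hS : S.IsHermitian),
      0 ≤ traceCosh θ S := fun hS => by
    rw [traceCosh_eq θ hS]
    exact Finset.sum_nonneg fun i _ => (Real.cosh_pos _).le
  induction m generalizing S with
  | zero => simp [expect_zero, signedSum]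
  | succ m ih =>
    rcases isEmpty_or_nonempty γ with hγ | ⟨⟨g₀⟩⟩
    · simp at hp1
    -- Isotropy at the identity matrix reads `R = c d`, which forces `c > 0`.
    have hc : 0 ≤ 1 + c / R * (Real.cosh (θ * R) - 1) := by
      have h1 := hA 1 Matrix.isHermitian_one
      simp only [sesq_one, hAR, Complex.ofReal_re, ← Finset.sum_mul, hp1, Matrix.trace_one] at h1
      simp at h1
      have hd : (0 : ℝ) < d := by
        rcases Nat.eq_zero_or_pos d with h | h
        · subst h; simp at h1; linarith
        · exact_mod_cast h
      have hc : 0 < c := pos_of_mul_pos_left (by rw [← h1]; exact hR) hd.le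
      have := Real.one_le_cosh (θ * R)
      have : 0 ≤ Real.cosh (θ * R) - 1 := by linarith
      positivity
    rw [expect_succ, sum_signedWeight_mul]
    have hsucc : ∀ (g : γ) (s : Bool) (y : Fin m → γ × Bool),
        S + signedSum A (Fin.cons (g, s) y : Fin (m + 1) → γ × Bool) =
          (S + (boolSign s : ℂ) • rankOne (A g)) + signedSum A y := by
      intro g s y
      simp only [signedSum, Fin.sum_univ_succ, Fin.cons_zero, Fin.cons_succ, add_assoc]
    simp only [hsucc]
    have ht : ((boolSign true : ℝ) : ℂ) = 1 := by simp [boolSign]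
    have hf : ((boolSign false : ℝ) : ℂ) = -1 := by simp [boolSign]
    simp only [ht, hf, one_smul, neg_smul, ← sub_eq_add_neg]
    refine le_trans (Finset.sum_le_sum fun g _ => mul_le_mul_of_nonneg_left
      (div_le_div_of_nonneg_right (add_le_add (ih (hS.add (rankOne_isHermitian (A g))))
        (ih (hS.sub (rankOne_isHermitian (A g))))) zero_le_two) (hp g)) ?_
    refine le_trans (le_of_eq ?_) ((mul_le_mul_of_nonneg_right (hstep hS)
      (pow_nonneg hc m)).trans_eq (by rw [pow_succ]; ring))
    rw [Finset.sum_mul]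
    exact Finset.sum_congr rfl fun g _ => by ring

/-- Jensen's inequality for `log`, through its tangent at `τ`. -/
lemma expect_log_div_le {p : γ → ℝ} (hp : ∀ g, 0 ≤ p g) (hp1 : ∑ g, p g = 1) {m : ℕ}
    (T : (Fin m → γ) → ℝ) (hT : ∀ x, 0 < T x) {τ θ : ℝ} (hτ : 0 < τ) (hθ : 0 < θ)
    (h : expect p T ≤ τ) :
    expect p (fun x => Real.log (2 * T x) / θ) ≤ Real.log (2 * τ) / θ := by
  have h1 : ∀ x, Real.log (2 * T x) / θ ≤ θ⁻¹ * (Real.log (2 * τ) - 1) + (θ * τ)⁻¹ * T x := by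
    intro x
    have h2 := Real.log_le_sub_one_of_pos (div_pos (hT x) hτ)
    have h3 : Real.log (2 * T x) = Real.log (2 * τ) + Real.log (T x / τ) := by
      rw [← Real.log_mul (by positivity) (div_pos (hT x) hτ).ne']
      congr 1; field_simp
    rw [h3]
    have h4 : (Real.log (2 * τ) + Real.log (T x / τ)) / θ ≤
      (Real.log (2 * τ) + (T x / τ - 1)) / θ := by gcongr
    refine h4.trans_eq ?_
    field_simp
    ring
  refine (expect_mono hp h1).trans ?_
  rw [expect_add, expect_const hp1, expect_const_mul]
  have h2 : (θ * τ)⁻¹ * expect p T ≤ (θ * τ)⁻¹ * τ := mul_le_mul_of_nonneg_left h (by positivity)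
  refine (add_le_add le_rfl h2).trans_eq ?_
  field_simp
  ring

end SignedSum

lemma cosh_sub_one_le_sq {x : ℝ} (hx : |x| ≤ 1) : Real.cosh x - 1 ≤ x ^ 2 := by
  have h1 := Real.cosh_le_exp_half_sq x
  have h2 : x ^ 2 ≤ 1 := by rw [← sq_abs]; exact pow_le_one₀ (abs_nonneg _) hx
  have h3 := Real.abs_exp_sub_one_le (x := x ^ 2 / 2) (by rw [abs_of_nonneg (by positivity)]; linarith)
  rw [abs_of_nonneg (a := x ^ 2 / 2) (by positivity)] at h3
  have := le_abs_self (Real.exp (x ^ 2 / 2) - 1)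
  linarith

section Design

variable {G : Set (EuclideanSpace ℂ (Fin d))} {μ : Measure (EuclideanSpace ℂ (Fin d))}

/-- The expected operator norm of the signed sum of the rank one matrices of a sample from a
spherical 2-design. -/
lemma exists_expect_opNorm_signedSum_le (hd : 1 ≤ d) (hG : IsSphericalTwoDesign G μ) [Fintype G]
    {m : ℕ} (hm : d * Real.log (2 * d) ≤ m) (hm0 : 0 < m) :
    ∃ L : (Fin m → G × Bool) → ℝ,
      (∀ y, 0 ≤ L y ∧ NumericallyBounded (signedSum (fun g : G => (rescale g.1).ofLp) y) (L y)) ∧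
      expect (signedWeight fun g : G => μ.real {(g : EuclideanSpace ℂ (Fin d))}) L ≤
        2 * √(m * (d + 1) * Real.log (2 * d)) := by
  have hd0 : (0 : ℝ) < d := by exact_mod_cast hd
  have hd1 : (1 : ℝ) ≤ d := by exact_mod_cast hd
  have hm1 : (0 : ℝ) < m := by exact_mod_cast hm0
  set ℓ := Real.log (2 * d) with hℓ
  have hℓ0 : 0 < ℓ := Real.log_pos (by linarith)
  -- This makes `(θR)² / d = ℓ / m`, so `m` samples multiply the initial potential `d` by at most
  -- `exp ℓ = 2d`; the final bound is `log (2 d exp ℓ) / θ = 2ℓ / θ`.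
  set θ := √(ℓ / (m * (d + 1))) with hθ
  have hθ0 : 0 < θ := Real.sqrt_pos.2 (by positivity)
  have hθ2 : θ ^ 2 = ℓ / (m * (d + 1)) := Real.sq_sqrt (by positivity)
  set p : G → ℝ := fun g => μ.real {(g : EuclideanSpace ℂ (Fin d))} with hp
  have hp0 : ∀ g, 0 ≤ p g := fun g => measureReal_nonneg
  have hp1 : ∑ g, p g = 1 := sum_weights hG
  set R := rescaleSq d with hR
  have hR0 : 0 < R := rescaleSq_pos hd
  have hR2 : R ^ 2 = d * (d + 1) := rescaleSq_sq d
  set A : G → Fin d → ℂ := fun g => (rescale g.1).ofLp with hA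
  have hE := expect_traceCosh_le (p := p) hp0 A (c := R / d) hR0
    (fun g => sum_norm_sq_rescale (hG.norm_eq_one _ g.2))
    (fun Z hZ => by
      have := design_sum_rescale hd hG hZ
      simpa only [quadForm_eq_re_sesq] using this) hp1 θ m
    (Matrix.isHermitian_zero (n := Fin d) (α := ℂ))
  simp only [zero_add, traceCosh_zero] at hE
  set q := 1 + R / d / R * (Real.cosh (θ * R) - 1) with hq
  -- The condition `d log (2d) ≤ m` serves to ensure `θ R ≤ 1`.
  have hcosh : Real.cosh (θ * R) - 1 ≤ (θ * R) ^ 2 := by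
    refine cosh_sub_one_le_sq ?_
    rw [abs_of_nonneg (by positivity)]
    refine (sq_le_one_iff₀ (by positivity)).1 ?_
    rw [mul_pow, hθ2, hR2]
    rw [div_mul_eq_mul_div, div_le_one (by positivity)]
    nlinarith
  have hq1 : q ≤ Real.exp (ℓ / m) := by
    have h1 : q ≤ 1 + ℓ / m := by
      have e : R / d / R = 1 / d := by field_simp
      rw [hq, e]
      have : (1 / d : ℝ) * (Real.cosh (θ * R) - 1) ≤ 1 / d * (θ * R) ^ 2 :=
        mul_le_mul_of_nonneg_left hcosh (by positivity)
      refine (add_le_add le_rfl this).trans_eq ?_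
      rw [mul_pow, hθ2, hR2]
      field_simp
    have := Real.add_one_le_exp (ℓ / m)
    linarith
  have hq0 : 0 ≤ q := by
    have := Real.one_le_cosh (θ * R)
    have : 0 ≤ Real.cosh (θ * R) - 1 := by linarith
    positivity
  have hqm : q ^ m ≤ Real.exp ℓ := by
    refine (pow_le_pow_left₀ hq0 hq1 m).trans_eq ?_
    rw [← Real.exp_nat_mul]
    congr 1; field_simp
  have hτ := hE.trans (mul_le_mul_of_nonneg_left hqm hd0.le)
  have hH := fun y : Fin m → G × Bool => signedSum_isHermitian A y
  have hT1 := fun y : Fin m → G × Bool => one_le_traceCosh hd θ (hH y)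
  refine ⟨fun y => Real.log (2 * traceCosh θ (signedSum A y)) / θ, fun y => ⟨?_, ?_⟩, ?_⟩
  · have := hT1 y
    exact div_nonneg (Real.log_nonneg (by linarith)) hθ0.le
  · exact numericallyBounded_log_traceCosh hθ0 (hH y)
  · have h := expect_log_div_le (signedWeight_nonneg hp0) (sum_signedWeight hp1)
      (fun y => traceCosh θ (signedSum A y)) (fun y => by have := hT1 y; linarith)
      (by positivity) hθ0 hτ
    refine h.trans_eq ?_
    rw [← mul_assoc, Real.log_mul (by positivity) (Real.exp_pos _).ne', Real.log_exp, ← hℓ]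
    have h2 : √(m * (d + 1) * ℓ) = ℓ / θ := by
      rw [Real.sqrt_eq_iff_mul_self_eq (by positivity) (by positivity), ← sq, div_pow, hθ2]
      field_simp
    rw [h2]; ring

end Design

/-! ### Uniform lower bound over error directions -/

/-- The normalized error directions: Hermitian matrices of Frobenius norm one that satisfy the
descent cone bound for rank `r` and are non-spiky with bound `b`. -/
structure IsErrorDirection (G : Set (EuclideanSpace ℂ (Fin d))) (r : ℕ) (b : ℝ)
    (H : Matrix (Fin d) (Fin d) ℂ) : Prop where
  isHermitian : H.IsHermitian
  frobeniusNorm_eq : frobeniusNorm H = 1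
  trace_le : ∀ S t, S.IsHermitian → 0 ≤ t → NumericallyBounded S t →
    |(S * H).trace.re| ≤ 3 * √r * t
  quadForm_le : ∀ g ∈ G, |quadForm H (rescale g)| ≤ b

section Design

variable {G : Set (EuclideanSpace ℂ (Fin d))} {μ : Measure (EuclideanSpace ℂ (Fin d))}

/-- The second moment is at least `‖H‖_F² = 1`, and it is at most `b` times the first absolute
moment because the quadratic form is bounded by `b`. -/
lemma IsErrorDirection.inv_le_sum (hd : 1 ≤ d) (hG : IsSphericalTwoDesign G μ) [Fintype G] {r : ℕ}
    {b : ℝ} (hb : 0 < b) {H : Matrix (Fin d) (Fin d) ℂ} (hH : IsErrorDirection G r b H) :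
    1 / b ≤ ∑ g : G, μ.real {(g : EuclideanSpace ℂ (Fin d))} * |quadForm H (rescale g.1)| := by
  have h := design_sum_rescale_sq hd hG hH.isHermitian
  rw [hH.frobeniusNorm_eq] at h
  have h2 : ∑ g : G, μ.real {(g : EuclideanSpace ℂ (Fin d))} * quadForm H (rescale g.1) ^ 2 ≤
      ∑ g : G, (μ.real {(g : EuclideanSpace ℂ (Fin d))} * |quadForm H (rescale g.1)|) * b := by
    refine Finset.sum_le_sum fun g _ => ?_
    rw [mul_assoc]
    refine mul_le_mul_of_nonneg_left ?_ measureReal_nonneg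
    rw [← sq_abs, sq]
    exact mul_le_mul_of_nonneg_left (hH.quadForm_le g g.2) (abs_nonneg _)
  rw [← Finset.sum_mul] at h2
  rw [div_le_iff₀ hb]
  nlinarith [sq_nonneg H.trace.re]

lemma IsErrorDirection.one_le (hd : 1 ≤ d) (hG : IsSphericalTwoDesign G μ) [Fintype G] {r : ℕ}
    {b : ℝ} (hb : 0 < b) {H : Matrix (Fin d) (Fin d) ℂ} (hH : IsErrorDirection G r b H) :
    1 ≤ b := by
  have h := hH.inv_le_sum hd hG hb
  have h2 : ∑ g : G, μ.real {(g : EuclideanSpace ℂ (Fin d))} * |quadForm H (rescale g.1)| ≤ b := by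
    refine (Finset.sum_le_sum fun (g : G) _ => mul_le_mul_of_nonneg_left
      (hH.quadForm_le g.1 g.2) measureReal_nonneg).trans_eq ?_
    rw [← Finset.sum_mul, sum_weights hG, one_mul]
  have h3 := h.trans h2
  rw [div_le_iff₀ hb] at h3
  nlinarith

/-- The uniform lower bound for the `ℓ₁` norm of the samples of the error directions fails with
exponentially small probability. -/
lemma expect_exists_errorDirection_le (hd : 1 ≤ d) (hG : IsSphericalTwoDesign G μ) [Fintype G]
    {r m : ℕ} (hr : 1 ≤ r) (hm0 : 0 < m) {b : ℝ} (hb : 0 < b)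
    (hm : (104 * b ^ 2) ^ 2 * (r * d * Real.log (2 * d)) ≤ m) :
    expect (fun g : G => μ.real {(g : EuclideanSpace ℂ (Fin d))}) (Set.indicator
      {x : Fin m → G | ∃ H, IsErrorDirection G r b H ∧
        ∑ i, |quadForm H (rescale (x i).1)| < m / (8 * b)} 1) ≤
      Real.exp (-(1 / 128) * m * ((b ^ 2) ^ 2)⁻¹) := by
  set p : G → ℝ := fun g => μ.real {(g : EuclideanSpace ℂ (Fin d))} with hp
  have hp0 : ∀ g, 0 ≤ p g := fun g => measureReal_nonneg
  have hp1 : ∑ g, p g = 1 := sum_weights hG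
  have hm1 : (0 : ℝ) < m := by exact_mod_cast hm0
  have hd1 : (1 : ℝ) ≤ d := by exact_mod_cast hd
  have hr1 : (1 : ℝ) ≤ r := by exact_mod_cast hr
  have hℓ0 : 0 < Real.log (2 * d) := Real.log_pos (by linarith)
  -- Without error directions the bad event is empty. Otherwise `b ≥ 1`, which the estimates below
  -- need, and the suprema run over a nonempty family.
  by_cases hne : ∃ H, IsErrorDirection G r b H
  swap
  · push Not at hne
    have : {x : Fin m → G | ∃ H, IsErrorDirection G r b H ∧
        ∑ i, |quadForm H (rescale (x i).1)| < m / (8 * b)} = ∅ := by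
      ext x
      simp only [Set.mem_ofPred_eq, Set.mem_empty_iff_false, iff_false]
      rintro ⟨H, hH, -⟩
      exact hne H hH
    rw [this, Set.indicator_empty]
    have h0 := expect_const hp1 m 0
    exact h0.trans_le (Real.exp_nonneg _)
  obtain ⟨H₀, hH₀⟩ := hne
  have hb1 : 1 ≤ b := hH₀.one_le hd hG hb
  let κ := {H : Matrix (Fin d) (Fin d) ℂ // IsErrorDirection G r b H}
  have : Nonempty κ := ⟨⟨H₀, hH₀⟩⟩
  set f : κ → G → ℝ := fun k g => quadForm k.1 (rescale g.1) with hf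
  have hfb : ∀ k g, |f k g| ≤ b := fun k g => k.2.quadForm_le g.1 g.2
  set M : κ → ℝ := fun k => ∑ g, p g * |f k g| with hM
  have hMb : ∀ k, M k ≤ b := fun k =>
    (Finset.sum_le_sum fun g _ => mul_le_mul_of_nonneg_left (hfb k g) (hp0 g)).trans_eq
      (by rw [← Finset.sum_mul, hp1, one_mul])
  have hM1 : ∀ k, 1 / b ≤ M k := fun k => k.2.inv_le_sum hd hG hb
  set F : (Fin m → G) → ℝ := fun x => ⨆ k, ((0 : ℝ) + ∑ i, (M k - |f k (x i)|)) with hF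
  have hbdd : ∀ x : Fin m → G, BddAbove (Set.range fun k => (0 : ℝ) + ∑ i, (M k - |f k (x i)|)) := by
    intro x
    refine bddAbove_add_of_le (u := fun _ => (0 : ℝ)) (b := ∑ _i : Fin m, b) ⟨0, by simp⟩
      fun k => Finset.sum_le_sum fun i _ => ?_
    have := hMb k; have := abs_nonneg (f k (x i)); linarith
  -- the expected supremum
  have hEF : expect p F ≤ 13 / 16 * (m / b) := by
    have hdm : d * Real.log (2 * d) ≤ m := by
      refine le_trans ?_ hm
      have h1 : 1 ≤ (104 * b ^ 2) ^ 2 := by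
        have : 1 ≤ 104 * b ^ 2 := by nlinarith
        nlinarith
      have h2 : d * Real.log (2 * d) ≤ r * d * Real.log (2 * d) := by
        rw [mul_assoc]
        exact le_mul_of_one_le_left (by positivity) hr1
      exact h2.trans (le_mul_of_one_le_left (by positivity) h1)
    obtain ⟨L, hL, hEL⟩ := exists_expect_opNorm_signedSum_le hd hG hdm hm0
    have h1 := expect_iSup_centered_abs_le hp0 hp1 f hfb m (fun _ => 0) ⟨0, by simp⟩
    have h2 : ∀ y : Fin m → G × Bool,
        ⨆ k, ((0 : ℝ) + ∑ i, 2 * (boolSign (y i).2 * f k (y i).1)) ≤ 6 * √r * L y := by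
      intro y
      refine ciSup_le fun k => ?_
      have h3 := k.2.trace_le _ _ (signedSum_isHermitian _ y) (hL y).1 (hL y).2
      rw [trace_signedSum_mul] at h3
      simp only [← quadForm_eq_re_sesq] at h3
      rw [zero_add, ← Finset.mul_sum]
      have := (le_abs_self _).trans h3
      linarith
    have h3 := h1.trans (expect_mono (signedWeight_nonneg hp0) h2)
    rw [expect_const_mul] at h3
    refine h3.trans ((mul_le_mul_of_nonneg_left hEL (by positivity)).trans ?_)
    -- The constant `52 = 104 / 2` leaves room for `d + 1 ≤ 2d`. The prefactor `6 · 2 = 12` then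
    -- gives `12/52`, well below `13/16`.
    have h4 : √r * √(m * (d + 1) * Real.log (2 * d)) ≤ m / (52 * b ^ 2) := by
      rw [← Real.sqrt_mul (by positivity)]
      refine Real.sqrt_le_iff.2 ⟨by positivity, ?_⟩
      rw [div_pow, le_div_iff₀ (by positivity)]
      have h5 : (d + 1 : ℝ) * (r * Real.log (2 * d)) ≤ 2 * d * (r * Real.log (2 * d)) :=
        mul_le_mul_of_nonneg_right (by linarith) (by positivity)
      have h6 : (52 * b ^ 2) ^ 2 * ((d + 1 : ℝ) * (r * Real.log (2 * d))) ≤ m := by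
        refine le_trans (mul_le_mul_of_nonneg_left h5 (by positivity)) ?_
        have h7 : 0 ≤ (b ^ 2) ^ 2 * (r * d * Real.log (2 * d)) := by positivity
        nlinarith
      nlinarith
    have h5 : (m : ℝ) / (52 * b ^ 2) ≤ m / b / 52 := by
      rw [div_div, div_le_div_iff_of_pos_left hm1 (by positivity) (by positivity)]
      nlinarith
    have h6 : 0 < (m : ℝ) / b := by positivity
    nlinarith
  -- bounded differences
  have hdiff : ∀ x i g, F (Function.update x i g) ≤ F x + b := by
    intro x i g
    refine ciSup_le fun k => ?_
    have h1 := le_ciSup (hbdd x) k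
    have h2 : ∑ j, (M k - |f k (Function.update x i g j)|) ≤ ∑ j, (M k - |f k (x j)|) + b := by
      rw [← Finset.add_sum_erase _ _ (Finset.mem_univ i),
        ← Finset.add_sum_erase Finset.univ (fun j => M k - |f k (x j)|) (Finset.mem_univ i)]
      have h3 : ∑ j ∈ Finset.univ.erase i, (M k - |f k (Function.update x i g j)|) =
          ∑ j ∈ Finset.univ.erase i, (M k - |f k (x j)|) := by
        refine Finset.sum_congr rfl fun j hj => ?_
        rw [Function.update_of_ne (Finset.ne_of_mem_erase hj)]
      rw [h3, Function.update_self]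
      have := abs_nonneg (f k g)
      have := hfb k (x i)
      linarith
    change _ ≤ (⨆ k, ((0 : ℝ) + ∑ i, (M k - |f k (x i)|))) + b
    linarith
  -- Of the mean `m / b`, the expected deficit takes `13/16` and the deviation `1/16`, leaving
  -- `1/8`; the exponent is `2 / 16² = 1/128` times `m / b⁴`.
  have hmc := mcdiarmid hp0 hp1 hb hm0 F hdiff (t := m / (16 * b)) (by positivity)
  refine (expect_mono hp0 fun x => ?_).trans (hmc.trans_eq ?_)
  · refine Set.indicator_le_indicator_of_subset ?_ (fun _ => zero_le_one) x
    rintro x ⟨H, hH, hx⟩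
    have h1 := le_ciSup (hbdd x) ⟨H, hH⟩
    have h2 := hM1 ⟨H, hH⟩
    simp only [Finset.sum_sub_distrib, Finset.sum_const, Finset.card_univ, Fintype.card_fin,
      nsmul_eq_mul, zero_add] at h1
    have h3 : (m : ℝ) * (1 / b) ≤ m * M ⟨H, hH⟩ := mul_le_mul_of_nonneg_left h2 hm1.le
    have e1 : (m : ℝ) / (8 * b) = m / b / 8 := by field_simp
    have e2 : (m : ℝ) / (16 * b) = m / b / 16 := by field_simp
    have e3 : (m : ℝ) * (1 / b) = m / b := by field_simp
    rw [e1] at hx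
    rw [e3] at h3
    have h4 : F x = ⨆ k, ((m : ℝ) * M k - ∑ i, |f k (x i)|) := by
      simp only [hF, Finset.sum_sub_distrib, Finset.sum_const, Finset.card_univ, Fintype.card_fin,
        nsmul_eq_mul, zero_add]
    rw [← h4] at h1
    rw [Set.mem_ofPred_eq, e2]
    have h5 : ∑ i, |f ⟨H, hH⟩ (x i)| < m / b / 8 := hx
    linarith
  · congr 1
    field_simp
    norm_num

end Design

/-! ### From the lower bound to recovery -/

lemma frobeniusNorm_smul (c : ℝ) (Z : Matrix (Fin d) (Fin d) ℂ) :
    frobeniusNorm ((c : ℂ) • Z) = |c| * frobeniusNorm Z := by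
  rw [frobeniusNorm, frobeniusNorm, ← Real.sqrt_sq_eq_abs, ← Real.sqrt_mul (sq_nonneg c)]
  congr 1
  simp only [Finset.mul_sum, Matrix.smul_apply, smul_eq_mul, norm_mul, mul_pow, Complex.norm_real,
    Real.norm_eq_abs, sq_abs]

lemma quadForm_smul_left (c : ℝ) (Z : Matrix (Fin d) (Fin d) ℂ) (a : EuclideanSpace ℂ (Fin d)) :
    quadForm ((c : ℂ) • Z) a = c * quadForm Z a := by
  rw [quadForm_eq_re_sesq, sesq_smul, Complex.re_ofReal_mul, ← quadForm_eq_re_sesq]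

lemma quadForm_sub (Z Y : Matrix (Fin d) (Fin d) ℂ) (a : EuclideanSpace ℂ (Fin d)) :
    quadForm (Z - Y) a = quadForm Z a - quadForm Y a := by
  have : sesq (Z - Y) a = sesq Z a - sesq Y a := by
    simp [sesq, Matrix.sub_mulVec, dotProduct_sub]
  rw [quadForm_eq_re_sesq, this, Complex.sub_re, ← quadForm_eq_re_sesq, ← quadForm_eq_re_sesq]

/-- A feasible point whose nuclear norm is at most that of the true matrix, and whose error is
larger than `δ`, yields an error direction. -/
lemma isErrorDirection_of_lt {G : Set (EuclideanSpace ℂ (Fin d))} {r : ℕ} {β δ : ℝ} (hδ : 0 < δ)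
    {X Z : Matrix (Fin d) (Fin d) ℂ} (hX : X.IsHermitian) (hZ : Z.IsHermitian) (hr : X.rank ≤ r)
    (hle : nuclearNorm Z ≤ nuclearNorm X) (hXs : IsNonSpiky (rescale '' G) β X)
    (hZs : IsNonSpiky (rescale '' G) β Z) (hlt : δ < frobeniusNorm (Z - X)) :
    IsErrorDirection G r (2 * β / δ * √(1 + 1 / (d : ℝ)))
      (((frobeniusNorm (Z - X))⁻¹ : ℝ) • (Z - X)) := by
  set s := frobeniusNorm (Z - X) with hs
  have hs0 : 0 < s := hδ.trans hlt
  have hcast : (s⁻¹ : ℝ) • (Z - X) = ((s⁻¹ : ℝ) : ℂ) • (Z - X) := by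
    ext i j; simp
  rw [hcast]
  refine ⟨?_, ?_, ?_, ?_⟩
  · rw [Matrix.IsHermitian, Matrix.conjTranspose_smul, (hZ.sub hX).eq]
    simp
  · rw [frobeniusNorm_smul, abs_of_pos (inv_pos.2 hs0), ← hs, inv_mul_cancel₀ hs0.ne']
  · intro S t hS ht hSt
    have h := abs_re_trace_mul_le_of_descent hX hZ hr hle hS ht hSt
    rw [Matrix.mul_smul, Matrix.trace_smul, smul_eq_mul, Complex.re_ofReal_mul, abs_mul,
      abs_of_pos (inv_pos.2 hs0)]
    refine (mul_le_mul_of_nonneg_left h (inv_pos.2 hs0).le).trans_eq ?_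
    rw [← hs]
    field_simp
  · intro g hg
    have h1 := hXs _ ⟨g, hg, rfl⟩
    have h2 := hZs _ ⟨g, hg, rfl⟩
    rw [quadForm_smul_left, quadForm_sub, abs_mul, abs_of_pos (inv_pos.2 hs0)]
    have h3 := (abs_sub (quadForm Z (rescale g)) (quadForm X (rescale g))).trans (add_le_add h2 h1)
    have h4 : s⁻¹ ≤ δ⁻¹ := inv_anti₀ hδ hlt.le
    refine (mul_le_mul h4 h3 (abs_nonneg _) (inv_pos.2 hδ).le).trans_eq ?_
    ring

lemma sampling_sub {m : ℕ} (a : Fin m → EuclideanSpace ℂ (Fin d))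
    (Z Y : Matrix (Fin d) (Fin d) ℂ) : sampling a (Z - Y) = sampling a Z - sampling a Y := by
  ext i
  simp [sampling, quadForm_sub]

lemma sum_abs_quadForm_le {m : ℕ} (a : Fin m → EuclideanSpace ℂ (Fin d))
    (Z : Matrix (Fin d) (Fin d) ℂ) : ∑ i, |quadForm Z (a i)| ≤ √m * ‖sampling a Z‖ := by
  rw [EuclideanSpace.norm_eq, ← Real.sqrt_mul (by positivity)]
  refine Real.le_sqrt_of_sq_le ?_
  have h := sq_sum_le_card_mul_sum_sq (s := Finset.univ) (f := fun i => |quadForm Z (a i)|)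
  simpa [sampling] using h

section Design

variable {G : Set (EuclideanSpace ℂ (Fin d))} {μ : Measure (EuclideanSpace ℂ (Fin d))}

/-- A Hermitian matrix whose quadratic form vanishes on a rescaled design is zero. -/
lemma frobeniusNorm_eq_zero_of_quadForm (hd : 1 ≤ d) (hG : IsSphericalTwoDesign G μ)
    {H : Matrix (Fin d) (Fin d) ℂ} (hH : H.IsHermitian)
    (h : ∀ g ∈ G, quadForm H (rescale g) = 0) : frobeniusNorm H = 0 := by
  have := hG.finite.fintype
  have h1 := design_sum_rescale_sq hd hG hH
  have h2 : ∀ g : G, μ.real {(g : EuclideanSpace ℂ (Fin d))} * quadForm H (rescale g.1) ^ 2 = 0 :=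
    fun g => by rw [h g.1 g.2]; ring
  simp only [h2, Finset.sum_const_zero] at h1
  have := sq_nonneg (frobeniusNorm H)
  have := sq_nonneg H.trace.re
  exact pow_eq_zero_iff two_ne_zero |>.1 (by linarith)

/-- Without room for spikes every feasible point is exact. -/
lemma recoversUniformly_of_beta_eq_zero (hd : 1 ≤ d) (hG : IsSphericalTwoDesign G μ) {r m : ℕ}
    {δ κ : ℝ} (hδ : 0 < δ) (a : Fin m → EuclideanSpace ℂ (Fin d)) :
    RecoversUniformly (rescale '' G) r 0 δ κ a := by
  intro η X hX _ _ hXs ε _ Z hZ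
  have h : frobeniusNorm (Z - X) = 0 := by
    refine frobeniusNorm_eq_zero_of_quadForm hd hG (hZ.1.isHermitian.sub hX) fun g hg => ?_
    have h1 := hXs _ ⟨g, hg, rfl⟩
    have h2 := hZ.1.isNonSpiky _ ⟨g, hg, rfl⟩
    rw [zero_mul] at h1 h2
    rw [quadForm_sub, abs_nonpos_iff.1 h1, abs_nonpos_iff.1 h2, sub_zero]
  rw [h]
  exact le_max_of_le_left hδ.le

/-- The uniform lower bound on error directions implies uniform recovery. -/
lemma recoversUniformly_of_forall_le {r m : ℕ} {β δ κ b : ℝ} (hδ : 0 < δ) (hm : 0 < m)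
    (hb : b = 2 * β / δ * √(1 + 1 / (d : ℝ))) (hb0 : 0 < b)
    (hκ : (∃ H, IsErrorDirection G r b H) → 16 * b / √m ≤ κ)
    (a : Fin m → EuclideanSpace ℂ (Fin d))
    (hlow : ∀ H, IsErrorDirection G r b H → m / (8 * b) ≤ ∑ i, |quadForm H (a i)|) :
    RecoversUniformly (rescale '' G) r β δ κ a := by
  intro η X hX hr _ hXs ε hε Z hZ
  by_contra hcon
  push Not at hcon
  have hlt := (le_max_left _ _).trans_lt hcon
  have hlt2 := (le_max_right _ _).trans_lt hcon
  have hη : 0 ≤ η := (norm_nonneg _).trans hε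
  have hfeas : IsFeasible (rescale '' G) β η a (sampling a X + ε) X :=
    ⟨hX, by simpa using hε, hXs⟩
  have hdir := isErrorDirection_of_lt hδ hX hZ.1.isHermitian hr (hZ.2 X hfeas) hXs
    hZ.1.isNonSpiky hlt
  rw [← hb] at hdir
  set s := frobeniusNorm (Z - X) with hs
  have hs0 : 0 < s := hδ.trans hlt
  have h1 := hlow _ hdir
  have hcast : (s⁻¹ : ℝ) • (Z - X) = ((s⁻¹ : ℝ) : ℂ) • (Z - X) := by
    ext i j; simp
  simp only [hcast, quadForm_smul_left, abs_mul, abs_of_pos (inv_pos.2 hs0), ← Finset.mul_sum] at h1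
  have h2 := sum_abs_quadForm_le a (Z - X)
  -- Both `Z` and `X` reproduce the data up to `η`.
  have h3 : ‖sampling a (Z - X)‖ ≤ 2 * η := by
    have e : sampling a (Z - X) = (sampling a Z - (sampling a X + ε)) + ε := by
      rw [sampling_sub]; abel
    rw [e]
    refine (norm_add_le _ _).trans ?_
    have := hZ.1.close
    linarith
  have hm0 : (0 : ℝ) < m := by exact_mod_cast hm
  have hsq : 0 < √(m : ℝ) := Real.sqrt_pos.2 hm0
  have h4 : (m : ℝ) / (8 * b) ≤ s⁻¹ * (√m * (2 * η)) :=
    h1.trans (mul_le_mul_of_nonneg_left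
      (h2.trans (mul_le_mul_of_nonneg_left h3 hsq.le)) (inv_pos.2 hs0).le)
  have h5 : s ≤ 16 * b / √m * η := by
    have h6 : s * (m / (8 * b)) ≤ √m * (2 * η) := by
      have := mul_le_mul_of_nonneg_left h4 hs0.le
      rwa [← mul_assoc s, mul_inv_cancel₀ hs0.ne', one_mul] at this
    have h7 : s * √m ≤ 16 * b * η := by
      have e : s * (m / (8 * b)) = √m * (s * √m / (8 * b)) := by
        nth_rewrite 1 [← Real.mul_self_sqrt hm0.le]
        ring
      rw [e] at h6
      have := le_of_mul_le_mul_left h6 hsq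
      rw [div_le_iff₀ (by positivity)] at this
      linarith
    rw [div_mul_eq_mul_div, le_div_iff₀ hsq]
    exact h7
  have h8 := mul_le_mul_of_nonneg_right (hκ ⟨_, hdir⟩) hη
  linarith

/-! ### Transfer to the probability space -/

variable {Ω : Type*} [MeasurableSpace Ω] {P : Measure Ω} [IsProbabilityMeasure P]

/-- The probability of an event determined by independent samples from a finite set, as a finite
sum. -/
lemma measureReal_setOf_le_expect (hG : IsSphericalTwoDesign G μ) [Fintype G] {m : ℕ}
    {w : Fin m → Ω → EuclideanSpace ℂ (Fin d)} (hw : ∀ i, HasLaw (w i) μ P) (hindep : iIndepFun w P)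
    (bad : Set (Fin m → G)) (E : Set Ω)
    (hE : ∀ x : Fin m → G, x ∉ bad → ∀ ω, (∀ i, w i ω = x i) → ω ∉ E) :
    P.real E ≤ expect (fun g : G => μ.real {(g : EuclideanSpace ℂ (Fin d))})
      (Set.indicator bad 1) := by
  classical
  set N : Set Ω := ⋃ i, w i ⁻¹' Gᶜ with hN
  have hN0 : P.real N = 0 := by
    rw [measureReal_eq_zero_iff]
    refine measure_iUnion_null fun i => ?_
    rw [← Measure.map_apply_of_aemeasurable (hw i).aemeasurable
      hG.finite.measurableSet.compl, (hw i).map_eq, hG.carried]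
  -- Off the null set `N` the samples form one of finitely many tuples. Only subadditivity is
  -- applied to `E`, so it need not be measurable.
  have hsub : E ⊆ N ∪ ⋃ x ∈ (Finset.univ.filter (· ∈ bad) : Finset (Fin m → G)),
      ⋂ i ∈ Finset.univ, w i ⁻¹' {((x i : G) : EuclideanSpace ℂ (Fin d))} := by
    intro ω hω
    by_cases h : ∀ i, w i ω ∈ G
    · right
      let x : Fin m → G := fun i => ⟨w i ω, h i⟩
      have hx : x ∈ bad := by
        by_contra hx
        exact hE x hx ω (fun i => rfl) hω
      simp only [Set.mem_iUnion]
      exact ⟨x, by simpa using hx, by simp [x]⟩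
    · left
      push Not at h
      obtain ⟨i, hi⟩ := h
      exact Set.mem_iUnion.2 ⟨i, hi⟩
  refine (measureReal_mono hsub).trans ((measureReal_union_le _ _).trans ?_)
  rw [hN0, zero_add]
  refine (measureReal_biUnion_finset_le _ _).trans_eq ?_
  have hx : ∀ x : Fin m → G, P.real (⋂ i ∈ Finset.univ,
      w i ⁻¹' {((x i : G) : EuclideanSpace ℂ (Fin d))}) =
      ∏ i, μ.real {((x i : G) : EuclideanSpace ℂ (Fin d))} := by
    intro x
    rw [measureReal_def, hindep.measure_inter_preimage_eq_mul Finset.univ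
      (fun i _ => measurableSet_singleton _), ENNReal.toReal_prod]
    refine Finset.prod_congr rfl fun i _ => ?_
    rw [measureReal_def, ← (hw i).map_eq, Measure.map_apply_of_aemeasurable (hw i).aemeasurable
      (measurableSet_singleton _)]
  simp only [hx, expect, Set.indicator_apply, Pi.one_apply, mul_ite, mul_one, mul_zero,
    Finset.sum_filter]

end Design

end NonSpikyPhaseLift

end

theorem theorem3 (d m r : ℕ) (δ C₀ β ν : ℝ) (hδ : 0 < δ) (hC₀ : 13 < C₀)
    (hr : 1 ≤ r) (hrd : r ≤ d) (hβ : 0 ≤ β) (hν : ν = 2 * β / δ)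
    (G : Set (EuclideanSpace ℂ (Fin d))) (μ : Measure (EuclideanSpace ℂ (Fin d)))
    (hG : NonSpikyPhaseLift.IsSphericalTwoDesign G μ)
    {Ω : Type*} [MeasurableSpace Ω] (P : Measure Ω) [IsProbabilityMeasure P]
    (w : Fin m → Ω → EuclideanSpace ℂ (Fin d))
    (hw : ∀ i, HasLaw (w i) μ P) (hindep : iIndepFun w P)
    (hm : (8 * C₀ * ν ^ 2 * (1 + 1 / (d : ℝ))) ^ 2 * (r * d * Real.log (2 * d)) ≤ m) :
    let good : Set Ω := {ω | NonSpikyPhaseLift.RecoversUniformly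
      (NonSpikyPhaseLift.rescale '' G) r β δ
      (16 * ν ^ 2 / √(m : ℝ) * (1 + 1 / (d : ℝ)) * (1 + 13 / (C₀ - 13)))
      (fun i => NonSpikyPhaseLift.rescale (w i ω))}
    (0 < β → 1 - Real.exp (-(1 / 128) * m * ((ν ^ 2 * (1 + 1 / (d : ℝ))) ^ 2)⁻¹) ≤ P.real good) ∧
      (β = 0 → P.real good = 1) := by
  intro good
  have hd : 1 ≤ d := hr.trans hrd
  refine ⟨fun hβ0 => ?_, fun hβ0 => ?_⟩
  · have := hG.finite.fintype
    have hd0 : (0 : ℝ) < d := by exact_mod_cast hd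
    have hd1 : (1 : ℝ) ≤ d := by exact_mod_cast hd
    have hr0 : (0 : ℝ) < r := by exact_mod_cast hr
    have hℓ : 0 < Real.log (2 * d) := Real.log_pos (by linarith)
    have hν0 : 0 < ν := by rw [hν]; positivity
    have hC0 : 0 < C₀ := by linarith
    have hc0 : (0 : ℝ) < 1 + 1 / (d : ℝ) := by positivity
    have hm0 : 0 < m := by
      have : (0 : ℝ) < m := lt_of_lt_of_le (by positivity) hm
      exact_mod_cast this
    have hm1 : (0 : ℝ) < m := by exact_mod_cast hm0
    obtain ⟨b, hb⟩ : ∃ b : ℝ, b = 2 * β / δ * √(1 + 1 / (d : ℝ)) := ⟨_, rfl⟩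
    have hb0 : 0 < b := by rw [hb]; positivity
    have hb2 : b ^ 2 = ν ^ 2 * (1 + 1 / (d : ℝ)) := by
      rw [hb, mul_pow, Real.sq_sqrt hc0.le, hν]
    -- The constant is `104 = 8 · 13`, so this is where `C₀ > 13` enters the sample size.
    have hmb : (104 * b ^ 2) ^ 2 * (r * d * Real.log (2 * d)) ≤ m := by
      refine le_trans (mul_le_mul_of_nonneg_right ?_ (by positivity)) hm
      rw [hb2, mul_assoc (8 * C₀)]
      refine pow_le_pow_left₀ (by positivity) ?_ 2
      refine mul_le_mul_of_nonneg_right (by linarith) (by positivity)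
    -- The argument yields the factor `b`, the claim has `b² = ν² (1 + 1/d)`. Passing from one to
    -- the other needs `b ≥ 1`, which is known only when an error direction exists.
    have hκ : (∃ H, NonSpikyPhaseLift.IsErrorDirection G r b H) → 16 * b / √(m : ℝ) ≤
        16 * ν ^ 2 / √(m : ℝ) * (1 + 1 / (d : ℝ)) * (1 + 13 / (C₀ - 13)) := by
      rintro ⟨H, hH⟩
      have hb1 := hH.one_le hd hG hb0
      have h1 : 0 ≤ 13 / (C₀ - 13) := div_nonneg (by norm_num) (by linarith)
      have e : 16 * ν ^ 2 / √(m : ℝ) * (1 + 1 / (d : ℝ)) = 16 * b ^ 2 / √(m : ℝ) := by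
        rw [hb2]; ring
      rw [e]
      have h2 : 16 * b / √(m : ℝ) ≤ 16 * b ^ 2 / √(m : ℝ) := by
        gcongr
        nlinarith
      refine h2.trans (le_mul_of_one_le_right (by positivity) (by linarith))
    have hprob := NonSpikyPhaseLift.measureReal_setOf_le_expect hG hw hindep
      {x : Fin m → G | ∃ H, NonSpikyPhaseLift.IsErrorDirection G r b H ∧
        ∑ i, |NonSpikyPhaseLift.quadForm H (NonSpikyPhaseLift.rescale (x i).1)| < m / (8 * b)}
      goodᶜ (fun x hx ω hω => by
        rw [Set.mem_compl_iff, not_not]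
        refine NonSpikyPhaseLift.recoversUniformly_of_forall_le hδ hm0 hb hb0 hκ _
          fun H hH => ?_
        simp only [hω]
        by_contra hlt
        exact hx ⟨H, hH, not_le.1 hlt⟩)
    have hexp := NonSpikyPhaseLift.expect_exists_errorDirection_le hd hG hr hm0 hb0 hmb
    rw [hb2] at hexp
    -- Subadditivity suffices here, whether or not `good` is measurable.
    have hun : 1 ≤ P.real good + P.real goodᶜ := by
      have := measureReal_union_le (μ := P) good goodᶜ
      rwa [Set.union_compl_self, probReal_univ] at this
    linarith
  · have : good = Set.univ := by
      ext ω
      refine iff_of_true ?_ trivial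
      subst hβ0
      exact NonSpikyPhaseLift.recoversUniformly_of_beta_eq_zero hd hG hδ _
    rw [this, probReal_univ]
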